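/- Let $N=\{1,\dots,n\}$. A function $f:2^N\to\mathbb{R}$ is a *coverage function* with universe of size $u$ if there are subsets $T_1,\dots,T_n$ of a $u$-element set $U$ and weights $w(a)\ge 0$ $(a\in U)$ such that $f(S)=\sum_{a\in\bigcup_{i\in S}T_i}w(a)$ for all $S\subseteq N$. For a class $\mathcal F$ of functions $2^N\to\mathbb{R}$, a probability distribution $\mathcal D$ on $2^N$, integers $k,m\ge 0$, and reals $\alpha$ and $\delta\in[0,1)$, say that $\mathcal F$ is *$\alpha$-optimizable under the constraint $|S|\le k$ from $m$ samples over $\mathcal D$ with confidence $1-\delta$* if there is a randomized algorithm, of unrestricted running time and allowed to depend on $n,k,m,\mathcal D,\mathcal F$, which on input $\{(S_i,f(S_i))\}_{i=1}^m$ returns a set $S$ with $|S|\le k$ such that for every $f\in\mathcal F$ $$\Pr_{S_1,\dots,S_m\sim\mathcal D\text{ i.i.d.}}\Big[\mathbb{E}[f(S)]\ \ge\ \alpha\cdot\max_{|T|\le k}f(T)\Big]\ \ge\ 1-\delta,$$ where the expectation is over the internal randomness of the algorithm. **Theorem.** 1. For every constant $\epsilon>0$ there is a sequence of cardinality bounds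 $k=k(n)$ such that for every $d\in\mathbb{N}$ and every constant $\delta\in[0,1)$ the following holds for all sufficiently large $n$: for every distribution $\mathcal D$ on $2^N$ and every $m\le n^d$, the class of all coverage functions on $N$ is not $n^{-1/5+\epsilon}$-optimizable under the constraint $|S|\le k(n)$ from $m$ samples over $\mathcal D$ with confidence $1-\delta$. 2. There are constants $c>0$ and $q\in\mathbb{N}$ and a sequence of cardinality bounds $k=k(n)$ such that for every $d\in\mathbb{N}$ and every constant $\delta\in[0,1)$ the following holds for all sufficiently large $n$: for every distribution $\mathcal D$ on $2^N$ and every $m\le n^d$, the class of coverage functions on $N$ with universe of size at most $n^q$ is not $2^{-c\sqrt{\log n}}$-optimizable under the constraint $|S|\le k(n)$ from $m$ samples over $\mathcal D$ with confidence $1-\delta$. -/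

import Mathlib

open Filter

namespace OPS

/-- `f` is a coverage function on subsets of `{0, …, n-1}` with a universe of `u` elements (children):
there are sets `T i` in the universe and nonnegative weights `w` such that `f S` is the total
weight of the union of the `T i`, `i ∈ S`. -/
def IsCoverageOfSize {n : ℕ} (u : ℕ) (f : Finset (Fin n) → ℝ) : Prop :=
  ∃ (T : Fin n → Finset (Fin u)) (w : Fin u → ℝ),
    (∀ a, 0 ≤ w a) ∧ ∀ S : Finset (Fin n), f S = ∑ a ∈ S.biUnion T, w a

/-- The class of all coverage functions on a ground set of `n` elements (finite universe of any
size). -/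
def coverageFunctions (n : ℕ) : Set (Finset (Fin n) → ℝ) :=
  {f | ∃ u : ℕ, IsCoverageOfSize u f}

/-- The class of coverage functions on a ground set of `n` elements whose universe has at most
`n ^ d` elements. -/
def polySizedCoverageFunctions (d n : ℕ) : Set (Finset (Fin n) → ℝ) :=
  {f | ∃ u : ℕ, u ≤ n ^ d ∧ IsCoverageOfSize u f}

/-- A (randomized, not necessarily efficient) algorithm that reads `m` labelled samples
`(S, f S)` and returns a random set of at most `k` elements. -/
structure Algorithm (n k m : ℕ) where
  /-- the law of the returned set, given the samples -/
  output : (Fin m → Finset (Fin n) × ℝ) → PMF (Finset (Fin n))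
  /-- every set that may be returned is feasible -/
  card_le : ∀ x, ∀ S ∈ (output x).support, S.card ≤ k

/-- The expectation of `f` under a law `p` on subsets of the ground set. -/
noncomputable def expect {n : ℕ} (p : PMF (Finset (Fin n))) (f : Finset (Fin n) → ℝ) : ℝ :=
  ∑ S, (p S).toReal * f S

/-- The probability of the event `E` when `m` samples are drawn i.i.d. from `D`. -/
noncomputable def sampleProb {n : ℕ} (D : PMF (Finset (Fin n))) (m : ℕ)
    (E : Set (Fin m → Finset (Fin n))) : ℝ :=
  ∑ s, E.indicator (fun s => ∏ i, (D (s i)).toReal) s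

/-- The optimum `max {f T : |T| ≤ k}`. -/
noncomputable def optValue {n : ℕ} (k : ℕ) (f : Finset (Fin n) → ℝ) : ℝ :=
  (Finset.univ.filter fun T : Finset (Fin n) => T.card ≤ k).sup' ⟨∅, by simp⟩ f

/-- The class `F` of functions on subsets of a ground set of `n` elements is `α`-optimizable under
the constraint `|S| ≤ k` from `m` samples over the distribution `D`, with confidence `1 - δ`: some
algorithm (which may depend on `n`, `k`, `m`, `D`, `F`) has, for each `f ∈ F`, with probability at
least `1 - δ` over the samples, expected value (over its own randomness) at least `α` times the
optimum. -/
def OptimizableFromSamples {n : ℕ} (F : Set (Finset (Fin n) → ℝ)) (k : ℕ)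
    (D : PMF (Finset (Fin n))) (m : ℕ) (α δ : ℝ) : Prop :=
  ∃ A : Algorithm n k m, ∀ f ∈ F,
    1 - δ ≤ sampleProb D m
      {s | α * optValue k f ≤ expect (A.output fun i => (s i, f (s i))) f}

end OPS

/-!
Coverage functions cannot be optimized from samples because of a family of coverage functions with
one hidden good part each, which typical samples do not tell apart.

*Gadgets.* For `y ≤ ℓ` the linear function `y` is the combination
`∑ j ∈ {1, …, ℓ}, (-1) ^ (j - 1) C(ℓ, j) (ℓ / j) (1 - (1 - j / ℓ) ^ y)`, by Lagrange extrapolation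
(`sum_alternating_choose_mul_one_sub_pow`). Moving the negative terms to the other side gives two
nonnegative combinations that agree for `y ≤ ℓ`: a good one that contains the linear function, and a
bad one, which is bounded by `ℓ 2 ^ ℓ`. Each term `1 - (1 - j / ℓ) ^ y` is the coverage function
in which every item is covered by each element independently with probability `j / ℓ`; since only
sets of at most `ℓ` elements matter, `ℓ`-wise independence suffices, and it is provided by the
polynomials of degree less than `ℓ` over a finite field (`card_filter_polyValue_notMem`). Thus there
are two coverage functions on a set of `q` elements that agree on sets of at most `ℓ` elements, one
bounded independently of `q` and one reaching `q` (`exists_gadget`).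

*The hidden function.* The ground set is labelled at random by `r` parts of `q` elements each and
by `R` masking blocks. One part `i` carries the good gadget, the others the bad one, and a set
that hits every masking block has the maximal value whatever `i` is (`hidden`). Large sets hit
every block and small sets meet each part in at most `ℓ` elements (`card_revealing_le`), so that
polynomially many samples have the same values for all `i`. The output of the algorithm then does
not depend on `i`, and the value of a set of `q` elements, averaged over `i`, is about `q / r`, up
to factors that depend on `ℓ` only (`sum_hidden_le`), while the optimum is at least `q`
(`card_le_hidden`). Markov's inequality concludes (`not_optimizable_of_indistinguishable`).

*Parameters.* With `q = r ^ 2` and `R = r ^ 3`, sets of about `r ^ 3` elements are masked, and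
smaller ones meet a part in fewer than `n ^ (-ε)` elements on average if `r ^ 5` is below
`n ^ (1 - ε)`; hence the ratio `n ^ (-1 / 5 + ε)`. A bound `ℓ` that tends to infinity slowly makes the
failure probability smaller than every power of `n`. The universe has `q ^ ℓ` items up to
polynomial factors, which is polynomial when `log₂ q` is about `√(log₂ n)`; this gives the second
ratio.
-/

namespace OPS

open Finset

/-! ### Coverage functions of relations -/

open scoped Classical in
/-- The coverage function of a relation: item `a` is covered by `S` when some `x ∈ S` is related
to `a`, and the value of `S` is the total weight of the covered items. -/
noncomputable def relCoverage {X A : Type*} [Fintype A] (rel : X → A → Prop) (w : A → ℝ)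
    (S : Finset X) : ℝ :=
  ∑ a, if ∃ x ∈ S, rel x a then w a else 0

lemma relCoverage_eq_sum_filter {X A : Type*} [Fintype A] (rel : X → A → Prop) (w : A → ℝ)
    (S : Finset X) [DecidablePred fun a => ∃ x ∈ S, rel x a] :
    relCoverage rel w S = ∑ a with ∃ x ∈ S, rel x a, w a := by
  rw [relCoverage, sum_filter]
  exact sum_congr rfl fun a _ => by congr

lemma relCoverage_isCoverageOfSize {n : ℕ} {A : Type*} [Fintype A] (rel : Fin n → A → Prop)
    {w : A → ℝ} (hw : ∀ a, 0 ≤ w a) : IsCoverageOfSize (Fintype.card A) (relCoverage rel w) := by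
  classical
  let e := Fintype.equivFin A
  refine ⟨fun x => univ.filter fun a => rel x (e.symm a), fun a => w (e.symm a), fun a => hw _,
    fun S => ?_⟩
  have h : S.biUnion (fun x => univ.filter fun a => rel x (e.symm a))
      = univ.filter fun a => ∃ x ∈ S, rel x (e.symm a) := by
    ext a
    simp
  rw [h, relCoverage_eq_sum_filter, sum_filter, sum_filter, ← Equiv.sum_comp e.symm]

lemma relCoverage_nonneg {X A : Type*} [Fintype A] (rel : X → A → Prop) {w : A → ℝ}
    (hw : ∀ a, 0 ≤ w a) (S : Finset X) : 0 ≤ relCoverage rel w S :=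
  sum_nonneg fun a _ => by split_ifs <;> simp [hw a]

lemma relCoverage_le_sum {X A : Type*} [Fintype A] (rel : X → A → Prop) {w : A → ℝ}
    (hw : ∀ a, 0 ≤ w a) (S : Finset X) : relCoverage rel w S ≤ ∑ a, w a :=
  sum_le_sum fun a _ => by split_ifs <;> simp [hw a]

/-! ### Counting functions with prescribed values -/

/-- The number of functions that take values in `A` on `S` and arbitrary values elsewhere. -/
lemma card_filter_forall_mem {X Y : Type*} [Fintype X] [DecidableEq X] [Fintype Y] [DecidableEq Y]
    (S : Finset X) (A : Finset Y) [DecidablePred fun φ : X → Y => ∀ x ∈ S, φ x ∈ A] :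
    #{φ : X → Y | ∀ x ∈ S, φ x ∈ A} = #A ^ #S * Fintype.card Y ^ (Fintype.card X - #S) := by
  have h : ({φ : X → Y | ∀ x ∈ S, φ x ∈ A} : Finset (X → Y))
      = Fintype.piFinset fun x => if x ∈ S then A else univ := by
    ext φ
    simp only [mem_filter, mem_univ, true_and, Fintype.mem_piFinset]
    refine forall_congr' fun x => ?_
    by_cases hx : x ∈ S <;> simp [hx]
  rw [h, Fintype.card_piFinset]
  simp_rw [apply_ite Finset.card]
  rw [prod_ite, prod_const, prod_const, filter_mem_eq_inter, univ_inter, filter_notMem_eq_sdiff,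
    card_univ_sdiff, card_univ]

/-- The proportion of functions that take values in `A` on `S`. -/
lemma card_filter_forall_mem_eq {X Y : Type*} [Fintype X] [DecidableEq X] [Fintype Y]
    [DecidableEq Y] [Nonempty Y] (S : Finset X) (A : Finset Y)
    [DecidablePred fun φ : X → Y => ∀ x ∈ S, φ x ∈ A] :
    (#{φ : X → Y | ∀ x ∈ S, φ x ∈ A} : ℝ)
      = ((#A : ℝ) / Fintype.card Y) ^ #S * (Fintype.card Y : ℝ) ^ Fintype.card X := by
  have hY : (Fintype.card Y : ℝ) ≠ 0 := by exact_mod_cast Fintype.card_ne_zero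
  rw [card_filter_forall_mem, div_pow]
  push_cast
  rw [← Nat.add_sub_cancel' (card_le_univ S), pow_add]
  field_simp
  simp

/-! ### The extrapolation identity -/

/-- Lagrange extrapolation to `0` of the polynomial `t ↦ (1 - (1 - t / ℓ) ^ y) / (t / ℓ)`, whose
value at `0` is `y`, from its values at `1, …, ℓ`. -/
lemma sum_alternating_choose_mul_one_sub_pow {ℓ y : ℕ} (hℓ : 0 < ℓ) (hy : y ≤ ℓ) :
    ∑ j ∈ range ℓ, (-1 : ℝ) ^ j * (ℓ.choose (j + 1) * (ℓ / (j + 1 : ℕ)))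
      * (1 - (1 - (j + 1 : ℕ) / (ℓ : ℝ)) ^ y) = y := by
  have hℓ' : (ℓ : ℝ) ≠ 0 := by positivity
  rcases Nat.eq_zero_or_pos y with rfl | hy0
  · simp
  -- `P` has degree `y - 1 < ℓ` and `P 0 = y`; its `ℓ`-th forward difference at `0` vanishes, and
  -- the terms other than `P 0` are those of the sum, by the geometric sum formula
  let p : Polynomial ℝ := 1 - Polynomial.C (1 / (ℓ : ℝ)) * Polynomial.X
  let P : Polynomial ℝ := ∑ i ∈ range y, p ^ i
  have hp : p.natDegree ≤ 1 := by
    dsimp only [p]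
    compute_degree
  have hP : P.natDegree < ℓ := by
    refine lt_of_le_of_lt (Polynomial.natDegree_sum_le_of_forall_le (n := y - 1) _ _ ?_) (by omega)
    intro i hi
    rw [mem_range] at hi
    refine Polynomial.natDegree_pow_le.trans ?_
    nlinarith [show i ≤ y - 1 by omega]
  have hev : ∀ t : ℝ, P.eval t = ∑ i ∈ range y, (1 - t / ℓ) ^ i := by
    intro t
    simp [P, p, Polynomial.eval_finsetSum, div_eq_inv_mul]
  have h := congr_fun (Polynomial.fwdDiff_iter_eq_zero_of_degree_lt hP) 0
  rw [fwdDiff_iter_eq_sum_shift, sum_range_succ'] at h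
  simp only [hev, zero_add, nsmul_eq_mul, mul_one, zsmul_eq_mul, Pi.zero_apply] at h
  have hterm : ∀ j ∈ range ℓ, (-1 : ℝ) ^ j * (ℓ.choose (j + 1) * (ℓ / (j + 1 : ℕ)))
      * (1 - (1 - (j + 1 : ℕ) / (ℓ : ℝ)) ^ y)
      = (-1) ^ (ℓ + 1) * ((((-1 : ℤ) ^ (ℓ - (j + 1)) * (ℓ.choose (j + 1) : ℤ) : ℤ) : ℝ)
        * ∑ i ∈ range y, (1 - ((j + 1 : ℕ) : ℝ) / ℓ) ^ i) := by
    intro j hj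
    rw [mem_range] at hj
    have hj' : ((j + 1 : ℕ) : ℝ) ≠ 0 := by positivity
    have hgeom := geom_sum_mul_neg (1 - ((j + 1 : ℕ) : ℝ) / ℓ) y
    rw [← hgeom]
    have hsign : (-1 : ℝ) ^ (ℓ + 1) * (-1) ^ (ℓ - (j + 1)) = (-1) ^ j := by
      rw [← pow_add, show ℓ + 1 + (ℓ - (j + 1)) = 2 * (ℓ - j) + j by omega, pow_add, pow_mul]
      simp
    rw [← hsign]
    push_cast
    field_simp
    ring
  rw [sum_congr rfl hterm, ← mul_sum, eq_neg_of_add_eq_zero_left h]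
  have hs : (-1 : ℝ) ^ ℓ * (-1) ^ ℓ = 1 := by rw [← mul_pow]; simp
  simp only [Nat.sub_zero, Nat.choose_zero_right]
  push_cast
  simp [pow_succ]
  rw [← mul_assoc, hs, one_mul]

/-! ### Limited independence of polynomial values -/

/-- The value at `z` of the polynomial with coefficient vector `c`. -/
def polyValue {F : Type*} [CommRing F] {ℓ : ℕ} (c : Fin ℓ → F) (z : F) : F :=
  ∑ i, c i * z ^ (i : ℕ)

/-- The values of a uniformly random polynomial of degree less than `ℓ` at `ℓ` points are
independent: the proportion of polynomials that avoid `I` on a set `Z` of at most `ℓ` points is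
`(1 - |I| / |F|) ^ |Z|`. -/
lemma card_filter_polyValue_notMem {F : Type*} [Field F] [Fintype F] [DecidableEq F] {ℓ : ℕ}
    (hℓ : ℓ ≤ Fintype.card F) (I Z : Finset F) (hZ : #Z ≤ ℓ) :
    (#{c : Fin ℓ → F | ∀ z ∈ Z, polyValue c z ∉ I} : ℝ)
      = (1 - (#I : ℝ) / Fintype.card F) ^ #Z * (Fintype.card F : ℝ) ^ ℓ := by
  -- on exactly `ℓ` points, evaluation is a bijection with Vandermonde matrix
  obtain ⟨Z', hZZ', hZ'⟩ := exists_superset_card_eq hZ hℓ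
  let v : Fin ℓ ≃ Z' := (Z'.equivFinOfCardEq hZ').symm
  have hv : Function.Injective fun i => (v i : F) := Subtype.val_injective.comp v.injective
  let M := Matrix.vandermonde fun i => (v i : F)
  have hM : IsUnit M := by
    rw [Matrix.isUnit_iff_isUnit_det, isUnit_iff_ne_zero]
    exact Matrix.det_vandermonde_ne_zero_iff.2 hv
  have hbij : Function.Bijective M.mulVec :=
    ⟨Matrix.mulVec_injective_iff_isUnit.2 hM, Matrix.mulVec_surjective_iff_isUnit.2 hM⟩
  have hval : ∀ c i, M.mulVec c i = polyValue c (v i : F) := by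
    intro c i
    simp [M, Matrix.mulVec, dotProduct, Matrix.vandermonde_apply, polyValue, mul_comm]
  let S : Finset (Fin ℓ) := univ.filter fun i => (v i : F) ∈ Z
  have hS : #S = #Z := by
    refine card_bij (fun i _ => (v i : F)) (fun i hi => (mem_filter.1 hi).2)
      (fun i _ j _ h => hv h) (fun z hz => ⟨v.symm ⟨z, hZZ' hz⟩, ?_, by simp⟩)
    simpa [S] using hz
  have hcard : #{c : Fin ℓ → F | ∀ z ∈ Z, polyValue c z ∉ I}
      = #{u : Fin ℓ → F | ∀ i ∈ S, u i ∈ Iᶜ} := by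
    refine card_bij (fun c _ => M.mulVec c) ?_ (fun c _ d _ h => hbij.1 h) ?_
    · intro c hc
      simp only [mem_filter, mem_univ, true_and, mem_compl, S] at hc ⊢
      intro i hi
      rw [hval]
      exact hc _ hi
    · intro u hu
      obtain ⟨c, rfl⟩ := hbij.2 u
      refine ⟨c, ?_, rfl⟩
      simp only [mem_filter, mem_univ, true_and, mem_compl, S, hval] at hu ⊢
      intro z hz
      have := hu (v.symm ⟨z, hZZ' hz⟩)
      simpa [hz] using this
  have hF : (Fintype.card F : ℝ) ≠ 0 := by exact_mod_cast Fintype.card_ne_zero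
  rw [hcard, card_filter_forall_mem_eq, hS, Fintype.card_fin, card_compl,
    Nat.cast_sub (card_le_univ I), sub_div, div_self hF]

/-! ### Gadgets -/

/-- Two weightings of the same items, each item being covered by some of the elements of `F`. The
two coverage functions are equal on sets of at most `ℓ` elements, although the bad one never
exceeds `E` while the good one is at least `|F|` on the whole of `F`. -/
structure Gadget (F : Type) [Fintype F] (ℓ : ℕ) (E : ℝ) where
  /-- the items -/
  Child : Type
  /-- there are finitely many items -/
  fintypeChild : Fintype Child
  /-- which elements cover which items -/
  covers : F → Child → Prop
  /-- the good weights -/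
  good : Child → ℝ
  /-- the bad weights -/
  bad : Child → ℝ
  good_nonneg : ∀ c, 0 ≤ good c
  bad_nonneg : ∀ c, 0 ≤ bad c
  good_eq_bad : ∀ Z : Finset F, #Z ≤ ℓ → relCoverage covers good Z = relCoverage covers bad Z
  sum_bad_le : ∑ c, bad c ≤ E
  good_le : ∀ Z : Finset F, relCoverage covers good Z ≤ #Z + E
  card_le_good : (Fintype.card F : ℝ) ≤ relCoverage covers good univ
  sum_good_le : ∑ c, good c ≤ Fintype.card F + E

attribute [instance] Gadget.fintypeChild

section PolyGadget

variable {F : Type} [Field F] [Fintype F]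

/-- The items of the polynomial gadget: a private item for each element, and for each level
`j < ℓ` one item for each polynomial of degree less than `ℓ`. -/
abbrev PolyChild (F : Type) (ℓ : ℕ) : Type := F ⊕ (Fin ℓ × (Fin ℓ → F))

/-- An element `z` covers its private item, and the polynomials `P` of level `j` with
`P z ∈ I j`. -/
def polyCovers {ℓ : ℕ} (I : Fin ℓ → Finset F) (z : F) : PolyChild F ℓ → Prop
  | Sum.inl z' => z' = z
  | Sum.inr (j, c) => polyValue c z ∈ I j

/-- The absolute values `C(ℓ, j + 1) ℓ / (j + 1)` of the extrapolation coefficients. -/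
noncomputable def levelWeight (ℓ j : ℕ) : ℝ := ℓ.choose (j + 1) * (ℓ / (j + 1 : ℕ))

/-- Weight `a` for the private items, and total weight `b j` for the polynomials of level `j`. -/
noncomputable def polyWeight {ℓ : ℕ} (a : ℝ) (b : ℕ → ℝ) : PolyChild F ℓ → ℝ
  | Sum.inl _ => a
  | Sum.inr (j, _) => b j / (Fintype.card F : ℝ) ^ ℓ

lemma levelWeight_nonneg (ℓ j : ℕ) : 0 ≤ levelWeight ℓ j := by
  unfold levelWeight; positivity

lemma sum_levelWeight_le (ℓ : ℕ) : ∑ j ∈ range ℓ, levelWeight ℓ j ≤ ℓ * 2 ^ ℓ := by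
  have h : ∀ j ∈ range ℓ, levelWeight ℓ j ≤ ℓ * ℓ.choose (j + 1) := by
    intro j _
    have : (ℓ : ℝ) / (j + 1 : ℕ) ≤ ℓ :=
      div_le_self (by positivity) (by push_cast; linarith [(Nat.cast_nonneg j : (0 : ℝ) ≤ j)])
    rw [levelWeight, mul_comm]
    gcongr
  refine (sum_le_sum h).trans ?_
  rw [← mul_sum]
  gcongr
  have := Nat.sum_range_choose ℓ
  rw [sum_range_succ'] at this
  exact_mod_cast (by omega : ∑ j ∈ range ℓ, ℓ.choose (j + 1) ≤ 2 ^ ℓ)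

lemma polyWeight_nonneg {ℓ : ℕ} {a : ℝ} {b : ℕ → ℝ} (ha : 0 ≤ a) (hb : ∀ j, 0 ≤ b j)
    (c : PolyChild F ℓ) : 0 ≤ polyWeight a b c := by
  rcases c with z | ⟨j, c⟩
  · exact ha
  · exact div_nonneg (hb j) (by positivity)

lemma sum_polyWeight (ℓ : ℕ) (a : ℝ) (b : ℕ → ℝ) :
    ∑ c : PolyChild F ℓ, polyWeight a b c = Fintype.card F * a + ∑ j ∈ range ℓ, b j := by
  have hF : (Fintype.card F : ℝ) ≠ 0 := by exact_mod_cast Fintype.card_ne_zero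
  rw [Fintype.sum_sum_type, Fintype.sum_prod_type, ← Fin.sum_univ_eq_sum_range]
  simp only [polyWeight, sum_const, card_univ, Fintype.card_fun, Fintype.card_fin, nsmul_eq_mul]
  congr 1
  refine sum_congr rfl fun j _ => ?_
  push_cast
  field_simp

/-- The private items contribute linearly, the polynomials through their proportion hit. -/
lemma relCoverage_polyCovers [DecidableEq F] {ℓ : ℕ} (I : Fin ℓ → Finset F) (a : ℝ) (b : ℕ → ℝ)
    (Z : Finset F) :
    relCoverage (polyCovers I) (polyWeight a b) Z = #Z * a
      + ∑ j : Fin ℓ, relCoverage (fun z c => polyValue c z ∈ I j)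
          (fun _ : Fin ℓ → F => b j / (Fintype.card F : ℝ) ^ ℓ) Z := by
  classical
  rw [relCoverage, Fintype.sum_sum_type, Fintype.sum_prod_type]
  congr 1
  simp [polyCovers, polyWeight, sum_ite_mem]

lemma relCoverage_polyValue [DecidableEq F] {ℓ : ℕ} (hℓ : ℓ ≤ Fintype.card F) (I Z : Finset F)
    (hZ : #Z ≤ ℓ) (b : ℝ) :
    relCoverage (fun z c => polyValue c z ∈ I)
        (fun _ : Fin ℓ → F => b / (Fintype.card F : ℝ) ^ ℓ) Z
      = b * (1 - (1 - (#I : ℝ) / Fintype.card F) ^ #Z) := by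
  classical
  have hF : (Fintype.card F : ℝ) ≠ 0 := by exact_mod_cast Fintype.card_ne_zero
  have h := card_filter_polyValue_notMem hℓ I Z hZ
  have h2 := card_filter_add_card_filter_not (s := (univ : Finset (Fin ℓ → F)))
    (fun c => ∃ z ∈ Z, polyValue c z ∈ I)
  have h3 : (#{c : Fin ℓ → F | ∃ z ∈ Z, polyValue c z ∈ I} : ℝ)
      = (1 - (1 - (#I : ℝ) / Fintype.card F) ^ #Z) * (Fintype.card F : ℝ) ^ ℓ := by
    push Not at h2
    rw [card_univ, Fintype.card_fun, Fintype.card_fin] at h2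
    have h2' := congrArg (Nat.cast (R := ℝ)) h2
    push_cast at h2'
    rw [sub_mul, one_mul, ← h, ← h2']
    ring
  rw [relCoverage_eq_sum_filter, sum_const, nsmul_eq_mul, h3]
  field_simp

variable (F)

/-- The good weights are the private items together with the even extrapolation terms, the bad
weights are the odd terms; equality on small sets is the extrapolation identity, since each level
sees only the size of a set of at most `ℓ` elements. -/
theorem exists_gadget {ℓ : ℕ} (hℓ : 0 < ℓ) (hd : ℓ ∣ Fintype.card F) :
    ∃ G : Gadget F ℓ (ℓ * 2 ^ ℓ),
      Fintype.card G.Child = Fintype.card F + ℓ * Fintype.card F ^ ℓ := by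
  classical
  have hF0 : 0 < Fintype.card F := Fintype.card_pos
  have hF : (Fintype.card F : ℝ) ≠ 0 := by exact_mod_cast hF0.ne'
  have hle : ℓ ≤ Fintype.card F := Nat.le_of_dvd hF0 hd
  obtain ⟨Q, hQ⟩ := hd
  have hI : ∀ j : Fin ℓ, ∃ I : Finset F, #I = (j + 1) * Q := by
    intro j
    obtain ⟨I, -, hI⟩ := exists_subset_card_eq (s := (univ : Finset F)) (n := (j + 1) * Q)
      (by rw [card_univ, hQ]; exact Nat.mul_le_mul_right _ j.2)
    exact ⟨I, hI⟩
  choose I hI using hI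
  have hfrac : ∀ j : Fin ℓ, (#(I j) : ℝ) / Fintype.card F = (j + 1 : ℕ) / (ℓ : ℝ) := by
    intro j
    have : (Q : ℝ) ≠ 0 := by
      rintro h
      rw [hQ] at hF
      simp [h] at hF
    rw [hI, hQ]
    push_cast
    field_simp
  -- level `j` stands for the term `j + 1` of the extrapolation, so `ev` lives on odd `j`
  let ev : ℕ → ℝ := fun j => if Even j then 0 else levelWeight ℓ j
  let od : ℕ → ℝ := fun j => if Even j then levelWeight ℓ j else 0
  have hev : ∀ j, 0 ≤ ev j := fun j => by
    dsimp only [ev]; split_ifs <;> simp [levelWeight_nonneg]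
  have hod : ∀ j, 0 ≤ od j := fun j => by
    dsimp only [od]; split_ifs <;> simp [levelWeight_nonneg]
  have hsev : ∑ j ∈ range ℓ, ev j ≤ ℓ * 2 ^ ℓ :=
    (sum_le_sum fun j _ => by
      dsimp only [ev]; split_ifs <;> simp [levelWeight_nonneg]).trans (sum_levelWeight_le ℓ)
  have hsod : ∑ j ∈ range ℓ, od j ≤ ℓ * 2 ^ ℓ :=
    (sum_le_sum fun j _ => by
      dsimp only [od]; split_ifs <;> simp [levelWeight_nonneg]).trans (sum_levelWeight_le ℓ)
  have hnn : ∀ j (Z : Finset F), 0 ≤ relCoverage (fun z c => polyValue c z ∈ I j)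
      (fun _ : Fin ℓ → F => ev j / (Fintype.card F : ℝ) ^ ℓ) Z := fun j Z =>
    relCoverage_nonneg _ (fun _ => div_nonneg (hev _) (by positivity)) Z
  refine ⟨⟨PolyChild F ℓ, inferInstance, polyCovers I, polyWeight 1 ev, polyWeight 0 od,
    polyWeight_nonneg zero_le_one hev, polyWeight_nonneg le_rfl hod, fun Z hZ => ?_, ?_,
    fun Z => ?_, ?_, ?_⟩, ?_⟩
  · rw [relCoverage_polyCovers, relCoverage_polyCovers]
    simp only [relCoverage_polyValue hle _ Z hZ, hfrac]
    have h := sum_alternating_choose_mul_one_sub_pow hℓ hZ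
    rw [← Fin.sum_univ_eq_sum_range (fun j => (-1 : ℝ) ^ j
      * (ℓ.choose (j + 1) * (ℓ / (j + 1 : ℕ))) * (1 - (1 - (j + 1 : ℕ) / (ℓ : ℝ)) ^ #Z))] at h
    rw [← h, mul_one, mul_zero, zero_add, ← sum_add_distrib]
    refine sum_congr rfl fun j _ => ?_
    rcases Nat.even_or_odd (j : ℕ) with hj | hj
    · simp [ev, od, hj, levelWeight, hj.neg_one_pow]
    · simp [ev, od, hj.neg_one_pow, levelWeight, Nat.not_even_iff_odd.2 hj]
  · rw [sum_polyWeight]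
    simpa using hsod
  · rw [relCoverage_polyCovers, mul_one]
    gcongr
    refine (sum_le_sum fun j _ => relCoverage_le_sum _
      (fun _ => div_nonneg (hev _) (by positivity)) Z).trans (le_trans (le_of_eq ?_) hsev)
    rw [← Fin.sum_univ_eq_sum_range]
    refine sum_congr rfl fun j _ => ?_
    simp only [sum_const, card_univ, Fintype.card_fun, Fintype.card_fin, nsmul_eq_mul]
    push_cast
    field_simp
  · rw [relCoverage_polyCovers, mul_one, card_univ]
    linarith [sum_nonneg fun j (_ : j ∈ (univ : Finset (Fin ℓ))) => hnn j univ]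
  · rw [sum_polyWeight, mul_one]
    gcongr
  · simp [PolyChild]

end PolyGadget

/-! ### Hidden coverage functions -/

section Family

/-- The roles an element of the ground set can have: to be one of the elements of a part of type
`F`, or to belong to one of `R` masking blocks. Each block consists of `B` labels, so that a
uniformly random label is mostly a masking one. -/
abbrev Label (F : Type) (r R B : ℕ) : Type := (Fin r × F) ⊕ (Fin R × Fin B)

open scoped Classical in
/-- The masking blocks that occur as labels in `S`. -/
noncomputable def blocksOf {F : Type} {n r R B : ℕ} (φ : Fin n → Label F r R B)
    (S : Finset (Fin n)) : Finset (Fin R) :=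
  {ρ | ∃ x ∈ S, ∃ b, φ x = Sum.inr (ρ, b)}

lemma card_blocksOf_le {F : Type} {n r R B : ℕ} (φ : Fin n → Label F r R B)
    (S : Finset (Fin n)) :
    #(blocksOf φ S) ≤ #S := by
  have h : ∀ ρ ∈ blocksOf φ S, ∃ x, x ∈ S ∧ ∃ b, φ x = Sum.inr (ρ, b) := fun ρ hρ => by
    simpa [blocksOf] using hρ
  choose g hg using h
  refine card_le_card_of_injective (f := fun ρ => ⟨g ρ.1 ρ.2, (hg ρ.1 ρ.2).1⟩) ?_
  rintro ⟨ρ, hρ⟩ ⟨ρ', hρ'⟩ he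
  obtain ⟨b, hb⟩ := (hg ρ hρ).2
  obtain ⟨b', hb'⟩ := (hg ρ' hρ').2
  rw [Subtype.mk.inj he, hb'] at hb
  simp only [Sum.inr.injEq, Prod.mk.injEq] at hb
  exact Subtype.ext hb.1.symm

variable {F : Type} [Fintype F] {ℓ : ℕ} {E : ℝ} (G : Gadget F ℓ E) {n r R B : ℕ}

/-- The items of the hidden function: `R` copies of the items of `r` gadgets and of an item that
no part covers. -/
abbrev Item (r R : ℕ) : Type := Fin R × Option (Fin r × G.Child)

/-- Masking labels cover one of the `R` copies entirely; labels in parts cover items of their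
gadget in every copy. -/
def labelCovers : Label F r R B → Item G r R → Prop
  | Sum.inr (ρ, _), (ρ', _) => ρ = ρ'
  | Sum.inl _, (_, none) => False
  | Sum.inl (j, z), (_, some (j', c)) => j = j' ∧ G.covers z c

/-- The weights of the gadget of part `j` when the good part is `i`. -/
def partWeight (i j : Fin r) : G.Child → ℝ := if j = i then G.good else G.bad

/-- The weights in one copy when the good part is `i`; the item that no part covers pads the total
weight to `|F| + r E`, which does not depend on `i`. -/
noncomputable def innerWeight (i : Fin r) : Option (Fin r × G.Child) → ℝ
  | none => Fintype.card F + r * E - ∑ j, ∑ c, partWeight G i j c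
  | some (j, c) => partWeight G i j c

/-- The coverage function with labelling `φ` and good part `i`. -/
noncomputable def hidden (φ : Fin n → Label F r R B) (i : Fin r) : Finset (Fin n) → ℝ :=
  relCoverage (fun x => labelCovers G (φ x)) fun a => innerWeight G i a.2 / R

open scoped Classical in
/-- The elements of part `j` that occur as labels in `S`. -/
noncomputable def partOf (φ : Fin n → Label F r R B) (S : Finset (Fin n)) (j : Fin r) : Finset F :=
  {z | ∃ x ∈ S, φ x = Sum.inl (j, z)}

/-- The value of `S` in a copy that is not masked. -/
noncomputable def inner (φ : Fin n → Label F r R B) (i : Fin r) (S : Finset (Fin n)) : ℝ :=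
  ∑ j, relCoverage G.covers (partWeight G i j) (partOf φ S j)

lemma partWeight_nonneg (i j : Fin r) (c : G.Child) : 0 ≤ partWeight G i j c := by
  unfold partWeight
  split_ifs
  exacts [G.good_nonneg c, G.bad_nonneg c]

lemma sum_partWeight_le (i : Fin r) :
    ∑ j, ∑ c, partWeight G i j c ≤ Fintype.card F + r * E := by
  have h : ∀ j, ∑ c, partWeight G i j c ≤ (if j = i then (Fintype.card F : ℝ) else 0) + E := by
    intro j
    unfold partWeight
    split_ifs
    · exact G.sum_good_le
    · simpa using G.sum_bad_le
  refine (sum_le_sum fun j _ => h j).trans ?_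
  simp [sum_add_distrib]

lemma innerWeight_nonneg (i : Fin r) (c : Option (Fin r × G.Child)) : 0 ≤ innerWeight G i c := by
  rcases c with _ | ⟨j, c⟩
  · exact sub_nonneg.2 (sum_partWeight_le G i)
  · exact partWeight_nonneg G i j c

lemma sum_innerWeight (i : Fin r) :
    ∑ c, innerWeight G i c = Fintype.card F + r * E := by
  rw [Fintype.sum_option, Fintype.sum_prod_type]
  simp [innerWeight]

lemma hidden_isCoverageOfSize (φ : Fin n → Label F r R B) (i : Fin r) :
    IsCoverageOfSize (R * (r * Fintype.card G.Child + 1)) (hidden G φ i) := by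
  have h := relCoverage_isCoverageOfSize (fun x => labelCovers G (φ x))
    (w := fun a : Item G r R => innerWeight G i a.2 / R)
    fun a => div_nonneg (innerWeight_nonneg G i _) (by positivity)
  have hc : Fintype.card (Item G r R) = R * (r * Fintype.card G.Child + 1) := by simp
  rw [← hc]
  exact h

lemma inner_eq (φ : Fin n → Label F r R B) (i : Fin r) (S : Finset (Fin n)) (ρ : Fin R)
    (hρ : ρ ∉ blocksOf φ S) :
    relCoverage (fun x c => labelCovers G (φ x) (ρ, c)) (innerWeight G i) S = inner G φ i S := by
  classical
  rw [relCoverage, Fintype.sum_option, Fintype.sum_prod_type]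
  have h0 : ¬ ∃ x ∈ S, labelCovers G (φ x) (ρ, none) := by
    rintro ⟨x, hx, h⟩
    rcases hφ : φ x with ⟨j, z⟩ | ⟨ρ', b⟩
    · simp [hφ, labelCovers] at h
    · simp only [hφ, labelCovers] at h
      exact hρ (by simpa [blocksOf, ← h] using ⟨x, hx, b, h ▸ hφ⟩)
  rw [if_neg h0, zero_add]
  refine sum_congr rfl fun j _ => sum_congr rfl fun c _ => ?_
  have h1 : (∃ x ∈ S, labelCovers G (φ x) (ρ, some (j, c))) ↔
      ∃ z ∈ partOf φ S j, G.covers z c := by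
    constructor
    · rintro ⟨x, hx, h⟩
      rcases hφ : φ x with ⟨j', z⟩ | ⟨ρ', b⟩
      · simp only [hφ, labelCovers] at h
        obtain ⟨rfl, h⟩ := h
        exact ⟨z, by simpa [partOf] using ⟨x, hx, hφ⟩, h⟩
      · simp only [hφ, labelCovers] at h
        exact absurd (by simpa [blocksOf, ← h] using ⟨x, hx, b, h ▸ hφ⟩) hρ
    · rintro ⟨z, hz, h⟩
      simp only [partOf, mem_filter, mem_univ, true_and] at hz
      obtain ⟨x, hx, hφ⟩ := hz
      exact ⟨x, hx, by simp [hφ, labelCovers, h]⟩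
  simp only [h1, innerWeight]

/-- The hidden function interpolates between its total weight and the value of the parts,
according to the proportion of masking blocks that are hit. -/
lemma hidden_eq (hR : 0 < R) (φ : Fin n → Label F r R B) (i : Fin r) (S : Finset (Fin n)) :
    hidden G φ i S = inner G φ i S
      + #(blocksOf φ S) / (R : ℝ) * (Fintype.card F + r * E - inner G φ i S) := by
  classical
  have hR' : (R : ℝ) ≠ 0 := by positivity
  have h : ∀ ρ : Fin R, relCoverage (fun x c => labelCovers G (φ x) (ρ, c))
      (fun c => innerWeight G i c / R) S = inner G φ i S / R
        + if ρ ∈ blocksOf φ S then (Fintype.card F + r * E - inner G φ i S) / R else 0 := by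
    intro ρ
    split_ifs with hρ
    · have hall : ∀ c, ∃ x ∈ S, labelCovers G (φ x) (ρ, c) := by
        intro c
        simp only [blocksOf, mem_filter, mem_univ, true_and] at hρ
        obtain ⟨x, hx, b, hφ⟩ := hρ
        exact ⟨x, hx, by simp [hφ, labelCovers]⟩
      simp only [relCoverage, hall, if_true]
      rw [← sum_div, sum_innerWeight]
      ring
    · rw [← inner_eq G φ i S ρ hρ, add_zero, relCoverage, relCoverage, sum_div]
      exact sum_congr rfl fun c _ => by split_ifs <;> simp
  rw [hidden, relCoverage, Fintype.sum_prod_type]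
  refine (sum_congr rfl fun ρ _ => h ρ).trans ?_
  rw [sum_add_distrib]
  simp only [sum_const, card_univ, Fintype.card_fin, nsmul_eq_mul, sum_ite_mem, univ_inter]
  field_simp

lemma inner_nonneg (φ : Fin n → Label F r R B) (i : Fin r) (S : Finset (Fin n)) :
    0 ≤ inner G φ i S :=
  sum_nonneg fun j _ => relCoverage_nonneg _ (partWeight_nonneg G i j) _

lemma inner_le_total (φ : Fin n → Label F r R B) (i : Fin r) (S : Finset (Fin n)) :
    inner G φ i S ≤ Fintype.card F + r * E :=
  (sum_le_sum fun j _ => relCoverage_le_sum _ (partWeight_nonneg G i j) _).trans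
    (sum_partWeight_le G i)

lemma hidden_nonneg (φ : Fin n → Label F r R B) (i : Fin r) (S : Finset (Fin n)) :
    0 ≤ hidden G φ i S :=
  relCoverage_nonneg _ (fun _ => div_nonneg (innerWeight_nonneg G i _) (by positivity)) S

/-- The value of a set that hits all masking blocks, or meets each part in few elements, does not
reveal the good part. -/
lemma hidden_eq_hidden (hR : 0 < R) (φ : Fin n → Label F r R B) (S : Finset (Fin n))
    (hS : (∀ ρ, ρ ∈ blocksOf φ S) ∨ ∀ j, #(partOf φ S j) ≤ ℓ) (i i' : Fin r) :
    hidden G φ i S = hidden G φ i' S := by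
  rw [hidden_eq G hR, hidden_eq G hR]
  rcases hS with hS | hS
  · have hR' : (R : ℝ) ≠ 0 := by positivity
    rw [show blocksOf φ S = univ by ext ρ; simp [hS], card_univ, Fintype.card_fin, div_self hR']
    ring
  · have h : ∀ i, inner G φ i S = ∑ j, relCoverage G.covers G.bad (partOf φ S j) := by
      intro i
      refine sum_congr rfl fun j _ => ?_
      unfold partWeight
      split_ifs
      · exact G.good_eq_bad _ (hS j)
      · rfl
    rw [h i, h i']

lemma card_le_hidden (hR : 0 < R) (φ : Fin n → Label F r R B) (i : Fin r) (S : Finset (Fin n))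
    (hS : ∀ z, ∃ x ∈ S, φ x = Sum.inl (i, z)) : (Fintype.card F : ℝ) ≤ hidden G φ i S := by
  have h1 : (Fintype.card F : ℝ) ≤ inner G φ i S := by
    refine le_trans ?_ (single_le_sum (f := fun j => relCoverage G.covers (partWeight G i j)
      (partOf φ S j)) (fun j _ => relCoverage_nonneg _ (partWeight_nonneg G i j) _) (mem_univ i))
    rw [show partOf φ S i = univ by ext z; simpa [partOf] using hS z]
    simpa [partWeight] using G.card_le_good
  rw [hidden_eq G hR]
  have h2 := inner_le_total G φ i S
  have h3 : 0 ≤ (#(blocksOf φ S) : ℝ) / R * (Fintype.card F + r * E - inner G φ i S) :=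
    mul_nonneg (by positivity) (by linarith)
  linarith

lemma sum_card_partOf_le (φ : Fin n → Label F r R B) (S : Finset (Fin n)) :
    ∑ j, #(partOf φ S j) ≤ #S := by
  rw [← card_sigma]
  have h : ∀ p ∈ univ.sigma (partOf φ S), ∃ x, x ∈ S ∧ φ x = Sum.inl (p.1, p.2) := by
    rintro ⟨j, z⟩ hp
    simpa [partOf] using hp
  choose g hg using h
  refine card_le_card_of_injective (f := fun p => ⟨g p.1 p.2, (hg p.1 p.2).1⟩) ?_
  rintro ⟨⟨j, z⟩, hp⟩ ⟨⟨j', z'⟩, hp'⟩ he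
  have h1 := (hg _ hp).2
  rw [Subtype.mk.inj he, (hg _ hp').2] at h1
  simp only [Sum.inl.injEq, Prod.mk.injEq] at h1
  obtain ⟨rfl, rfl⟩ := h1
  rfl

/-- A set of `k` elements chosen independently of the good part has a small value on average: it
hits at most `k` of the blocks, each part has bad value at most `E`, and the elements of the set
that lie in the good part number only `k / r` on average. -/
lemma sum_hidden_le (hE : 0 ≤ E) (hR : 0 < R) (φ : Fin n → Label F r R B) (S : Finset (Fin n))
    {k : ℕ} (hS : #S ≤ k) :
    ∑ i, hidden G φ i S ≤ r * (k / R * (Fintype.card F + r * E) + r * E) + k := by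
  have hin : ∀ i, inner G φ i S ≤ #(partOf φ S i) + r * E := by
    intro i
    have h : ∀ j, relCoverage G.covers (partWeight G i j) (partOf φ S j)
        ≤ (if j = i then (#(partOf φ S i) : ℝ) else 0) + E := by
      intro j
      unfold partWeight
      split_ifs with hj
      · rw [hj]
        exact G.good_le _
      · rw [zero_add]
        exact (relCoverage_le_sum _ G.bad_nonneg _).trans G.sum_bad_le
    refine (sum_le_sum fun j _ => h j).trans ?_
    simp [sum_add_distrib]
  have hW : (0 : ℝ) ≤ Fintype.card F + r * E := by positivity
  have h : ∀ i, hidden G φ i S ≤ #(partOf φ S i) + r * E + k / R * (Fintype.card F + r * E) := by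
    intro i
    rw [hidden_eq G hR]
    refine add_le_add (hin i) ?_
    have : (#(blocksOf φ S) : ℝ) ≤ k := by exact_mod_cast (card_blocksOf_le φ S).trans hS
    refine mul_le_mul (by gcongr) (by linarith [inner_nonneg G φ i S])
      (by linarith [inner_le_total G φ i S]) (by positivity)
  refine (sum_le_sum fun i _ => h i).trans ?_
  have hk : (∑ j, (#(partOf φ S j) : ℝ)) ≤ k := by
    exact_mod_cast (sum_card_partOf_le φ S).trans hS
  simp only [sum_add_distrib, sum_const, card_univ, Fintype.card_fin, nsmul_eq_mul]
  linarith

end Family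

/-! ### Averaging over indistinguishable functions -/

lemma sum_toReal_pmf {X : Type*} [Fintype X] (p : PMF X) : ∑ x, (p x).toReal = 1 := by
  rw [← ENNReal.toReal_sum fun x _ => p.apply_ne_top x, ← tsum_fintype (L := .unconditional _),
    p.tsum_coe, ENNReal.toReal_one]

lemma sum_prod_toReal_pmf {X : Type*} [Fintype X] (p : PMF X) (m : ℕ) :
    ∑ s : Fin m → X, ∏ i, (p (s i)).toReal = 1 := by
  classical
  have := (prod_univ_sum (fun _ : Fin m => (univ : Finset X)) fun _ x => (p x).toReal).symm
  simpa [sum_toReal_pmf] using this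

/-- Averaging over a family of functions that good samples do not tell apart: on a good sample the
algorithm returns a random set of the same law for all of them, and by Markov's inequality this is
a good answer for a small proportion of them only. -/
theorem not_optimizable_of_indistinguishable {n k m : ℕ} {D : PMF (Finset (Fin n))} {α δ V β : ℝ}
    {C : Set (Finset (Fin n) → ℝ)} {ι : Type*} [Fintype ι] [Nonempty ι]
    (f : ι → Finset (Fin n) → ℝ) (hf : ∀ i, f i ∈ C) (bad : Finset (Fin n) → Prop)
    (hbad : ∀ S, ¬ bad S → ∀ i i', f i S = f i' S)
    (hα : 0 < α) (hV : 0 < V) (hopt : ∀ i, V ≤ optValue k (f i))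
    (hnonneg : ∀ i S, 0 ≤ f i S)
    (havg : ∀ S, #S ≤ k → ∑ i, f i S ≤ Fintype.card ι * (β * V))
    (hlt : sampleProb D m {s | ∃ t, bad (s t)} + β / α < 1 - δ) :
    ¬ OptimizableFromSamples C k D m α δ := by
  classical
  rintro ⟨A, hA⟩
  let wt : (Fin m → Finset (Fin n)) → ℝ := fun s => ∏ i, (D (s i)).toReal
  have hwt : ∀ s, 0 ≤ wt s := fun s => prod_nonneg fun i _ => ENNReal.toReal_nonneg
  have hwt1 : ∑ s, wt s = 1 := sum_prod_toReal_pmf D m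
  let succ : ι → Set (Fin m → Finset (Fin n)) := fun i =>
    {s | α * optValue k (f i) ≤ expect (A.output fun t => (s t, f i (s t))) (f i)}
  have hcard : (0 : ℝ) < Fintype.card ι := by exact_mod_cast Fintype.card_pos
  have hexp : ∀ (p : PMF (Finset (Fin n))), (∀ S ∈ p.support, #S ≤ k) →
      ∑ i, expect p (f i) ≤ Fintype.card ι * (β * V) := by
    intro p hp
    simp only [expect]
    rw [sum_comm, ← one_mul (_ * _), ← sum_toReal_pmf p, sum_mul]
    refine sum_le_sum fun S _ => ?_
    rw [← mul_sum]
    by_cases hS : S ∈ p.support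
    · exact mul_le_mul_of_nonneg_left (havg S (hp S hS)) ENNReal.toReal_nonneg
    · rw [PMF.mem_support_iff, not_not] at hS
      simp [hS]
  have hβ : 0 ≤ β := by
    have h0 := (sum_nonneg fun i _ => hnonneg i ∅).trans (havg ∅ (by simp))
    have : 0 < Fintype.card ι * V := by positivity
    nlinarith
  have hpt : ∀ s, ∑ i, (succ i).indicator wt s
      ≤ Fintype.card ι * (({s | ∃ t, bad (s t)} : Set _).indicator wt s + wt s * (β / α)) := by
    intro s
    by_cases hs : ∃ t, bad (s t)
    · rw [Set.indicator_of_mem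
        (show s ∈ {s : Fin m → Finset (Fin n) | ∃ t, bad (s t)} from hs)]
      have h1 : ∑ i, (succ i).indicator wt s ≤ ∑ _i : ι, wt s :=
        sum_le_sum fun i _ => Set.indicator_le_self' (fun _ _ => hwt _) s
      have h2 : 0 ≤ wt s * (β / α) := mul_nonneg (hwt s) (by positivity)
      simp only [sum_const, card_univ, nsmul_eq_mul] at h1
      nlinarith
    · rw [Set.indicator_of_notMem
        (show s ∉ {s : Fin m → Finset (Fin n) | ∃ t, bad (s t)} from hs), zero_add]
      push Not at hs
      obtain ⟨i₀⟩ := ‹Nonempty ι›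
      -- the law of the output, the same for all `i`
      let p := A.output fun t => (s t, f i₀ (s t))
      have hp : ∀ i, A.output (fun t => (s t, f i (s t))) = p := by
        intro i
        congr 1
        funext t
        rw [hbad _ (hs t) i i₀]
      have hmk : ∀ i, (succ i).indicator wt s ≤ wt s * (expect p (f i) / (α * V)) := by
        intro i
        have he : 0 ≤ expect p (f i) :=
          sum_nonneg fun S _ => mul_nonneg ENNReal.toReal_nonneg (hnonneg i S)
        by_cases hi : s ∈ succ i
        · rw [Set.indicator_of_mem hi]
          have hi' : α * optValue k (f i) ≤ expect p (f i) := by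
            rw [← hp i]
            exact hi
          have : 1 ≤ expect p (f i) / (α * V) := by
            rw [one_le_div (by positivity)]
            exact (mul_le_mul_of_nonneg_left (hopt i) hα.le).trans hi'
          exact le_mul_of_one_le_right (hwt s) this
        · rw [Set.indicator_of_notMem hi]
          exact mul_nonneg (hwt s) (by positivity)
      refine (sum_le_sum fun i _ => hmk i).trans ?_
      rw [← mul_sum, ← sum_div]
      calc wt s * ((∑ i, expect p (f i)) / (α * V))
          ≤ wt s * ((Fintype.card ι * (β * V)) / (α * V)) := by
            have := hexp p fun S hS => A.card_le _ S hS
            have := hwt s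
            gcongr
        _ = _ := by field_simp
  have hsum : ∑ i, sampleProb D m (succ i)
      ≤ Fintype.card ι * (sampleProb D m {s | ∃ t, bad (s t)} + β / α) := by
    calc ∑ i, sampleProb D m (succ i) = ∑ s, ∑ i, (succ i).indicator wt s := by
          simp only [sampleProb]
          exact sum_comm
      _ ≤ _ := sum_le_sum fun s _ => hpt s
      _ = _ := by
          rw [← mul_sum, sum_add_distrib, ← sum_mul, hwt1, one_mul]
          rfl
  have hlow : (Fintype.card ι : ℝ) * (1 - δ) ≤ ∑ i, sampleProb D m (succ i) := by
    rw [← nsmul_eq_mul, ← card_univ, ← sum_const]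
    exact sum_le_sum fun i _ => hA (f i) (hf i)
  nlinarith

/-- First moment method: if each set is bad for few of the `φ ∈ Φ`, and few `φ` are spoiled, then
some unspoiled `φ` makes it unlikely that one of the samples is bad. -/
theorem exists_sampleProb_le {n : ℕ} (D : PMF (Finset (Fin n))) (m : ℕ) {Φ : Type*} [Fintype Φ]
    [Nonempty Φ] (bad : Φ → Finset (Fin n) → Prop) (spoiled : Φ → Prop) {η η' : ℝ}
    [∀ S, DecidablePred fun φ => bad φ S] [DecidablePred spoiled]
    (hbad : ∀ S, (#{φ | bad φ S} : ℝ) ≤ η * Fintype.card Φ)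
    (hsp : (#{φ | spoiled φ} : ℝ) ≤ η' * Fintype.card Φ) (hlt : η' + m * η < 1) :
    ∃ φ, ¬ spoiled φ ∧ sampleProb D m {s | ∃ t, bad φ (s t)} ≤ η' + m * η := by
  classical
  let wt : (Fin m → Finset (Fin n)) → ℝ := fun s => ∏ i, (D (s i)).toReal
  have hwt : ∀ s, 0 ≤ wt s := fun s => prod_nonneg fun i _ => ENNReal.toReal_nonneg
  have hwt1 : ∑ s, wt s = 1 := sum_prod_toReal_pmf D m
  have hpt : ∀ s : Fin m → Finset (Fin n),
      ∑ φ, ({s | ∃ t, bad φ (s t)} : Set _).indicator wt s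
        ≤ wt s * (m * η * Fintype.card Φ) := by
    intro s
    have h1 : ∀ φ, ({s | ∃ t, bad φ (s t)} : Set _).indicator wt s
        ≤ wt s * ∑ t, if bad φ (s t) then (1 : ℝ) else 0 := by
      intro φ
      by_cases h : ∃ t, bad φ (s t)
      · rw [Set.indicator_of_mem
        (show s ∈ {s : Fin m → Finset (Fin n) | ∃ t, bad φ (s t)} from h)]
        obtain ⟨t, ht⟩ := h
        refine le_mul_of_one_le_right (hwt s) ?_
        refine le_trans ?_ (single_le_sum (f := fun t => if bad φ (s t) then (1 : ℝ) else 0)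
          (fun t _ => by split_ifs <;> simp) (mem_univ t))
        simp [ht]
      · rw [Set.indicator_of_notMem
        (show s ∉ {s : Fin m → Finset (Fin n) | ∃ t, bad φ (s t)} from h)]
        exact mul_nonneg (hwt s) (sum_nonneg fun t _ => by split_ifs <;> simp)
    refine (sum_le_sum fun φ _ => h1 φ).trans ?_
    rw [← mul_sum, sum_comm]
    refine mul_le_mul_of_nonneg_left ?_ (hwt s)
    have h2 : ∀ t, (∑ φ, if bad φ (s t) then (1 : ℝ) else 0) ≤ η * Fintype.card Φ := fun t => by
      rw [sum_boole]
      exact hbad (s t)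
    refine (sum_le_sum fun t _ => h2 t).trans (le_of_eq ?_)
    simp [mul_assoc]
  have htot : ∑ φ, ((if spoiled φ then (1 : ℝ) else 0) + sampleProb D m {s | ∃ t, bad φ (s t)})
      ≤ ∑ _φ : Φ, (η' + m * η) := by
    rw [sum_add_distrib, sum_boole, sum_const, card_univ, nsmul_eq_mul]
    have : ∑ φ, sampleProb D m {s | ∃ t, bad φ (s t)} ≤ m * η * Fintype.card Φ := by
      simp only [sampleProb]
      rw [sum_comm]
      refine (sum_le_sum fun s _ => hpt s).trans ?_
      rw [← sum_mul, hwt1, one_mul]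
    linarith
  obtain ⟨φ, -, hφ⟩ := exists_le_of_sum_le univ_nonempty htot
  have hnn : 0 ≤ sampleProb D m {s | ∃ t, bad φ (s t)} :=
    sum_nonneg fun s _ => Set.indicator_nonneg (fun _ _ => hwt _) s
  refine ⟨φ, fun h => ?_, ?_⟩
  · rw [if_pos h] at hφ
    linarith
  · refine le_trans ?_ hφ
    split_ifs <;> simp

/-! ### Random labels -/

section RandomLabels

variable {F : Type} [Fintype F] {n r R B : ℕ}

/-- The value of `S` may reveal the good part: `S` misses a masking block and contains more than
`ℓ` elements of some part. -/
def Revealing (ℓ : ℕ) (φ : Fin n → Label F r R B) (S : Finset (Fin n)) : Prop :=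
  ¬ ((∀ ρ, ρ ∈ blocksOf φ S) ∨ ∀ j, #(partOf φ S j) ≤ ℓ)

/-- Some label of some part is not used. -/
def Incomplete (φ : Fin n → Label F r R B) : Prop :=
  ∃ p : Fin r × F, ∀ x, φ x ≠ Sum.inl p

variable [Nonempty (Label F r R B)]

open scoped Classical in
lemma card_incomplete_le :
    (#{φ : Fin n → Label F r R B | Incomplete φ} : ℝ)
      ≤ r * Fintype.card F * Real.exp (-(n / Fintype.card (Label F r R B)))
        * Fintype.card (Fin n → Label F r R B) := by
  set N := Fintype.card (Label F r R B) with hN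
  have hN1 : 1 ≤ N := Fintype.card_pos
  have hN0 : (N : ℝ) ≠ 0 := by positivity
  have hsub : ({φ : Fin n → Label F r R B | Incomplete φ} : Finset _)
      ⊆ univ.biUnion fun p : Fin r × F =>
        {φ : Fin n → Label F r R B | ∀ x ∈ univ,
          φ x ∈ ({Sum.inl p}ᶜ : Finset (Label F r R B))} := by
    intro φ hφ
    simpa [Incomplete] using hφ
  have hterm : ∀ p : Fin r × F, (#{φ : Fin n → Label F r R B | ∀ x ∈ univ,
      φ x ∈ ({Sum.inl p}ᶜ : Finset (Label F r R B))} : ℝ)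
      ≤ Real.exp (-(n / N)) * (N : ℝ) ^ n := by
    intro p
    rw [card_filter_forall_mem_eq, card_compl, card_singleton, card_univ, Fintype.card_fin, ← hN]
    gcongr
    rw [Nat.cast_sub hN1, sub_div, div_self hN0]
    calc (1 - ((1 : ℕ) : ℝ) / N) ^ n ≤ Real.exp (-(1 / N)) ^ n := by
          refine pow_le_pow_left₀ (sub_nonneg.2 ?_) ?_ n
          · rw [div_le_one (by positivity)]
            exact_mod_cast hN1
          · simpa using Real.one_sub_le_exp_neg (1 / (N : ℝ))
      _ = _ := by
          rw [← Real.exp_nat_mul]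
          congr 1
          ring
  calc (#{φ : Fin n → Label F r R B | Incomplete φ} : ℝ)
      ≤ ∑ p : Fin r × F, (#{φ : Fin n → Label F r R B | ∀ x ∈ univ,
        φ x ∈ ({Sum.inl p}ᶜ : Finset (Label F r R B))} : ℝ) := by
        exact_mod_cast (card_le_card hsub).trans card_biUnion_le
    _ ≤ ∑ _p : Fin r × F, Real.exp (-(n / N)) * (N : ℝ) ^ n := sum_le_sum fun p _ => hterm p
    _ = _ := by
        simp only [sum_const, card_univ, Fintype.card_prod, Fintype.card_fin, nsmul_eq_mul,
          Fintype.card_fun, ← hN]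
        push_cast
        ring

open scoped Classical in
/-- Large sets usually hit all masking blocks. -/
lemma card_forall_notMem_blocksOf_le (s₀ : ℕ) (S : Finset (Fin n)) (hS : s₀ ≤ #S) :
    (#{φ : Fin n → Label F r R B | ¬ ∀ ρ, ρ ∈ blocksOf φ S} : ℝ)
      ≤ R * Real.exp (-(s₀ * B / Fintype.card (Label F r R B)))
        * Fintype.card (Fin n → Label F r R B) := by
  set N := Fintype.card (Label F r R B) with hN
  have hN1 : 1 ≤ N := Fintype.card_pos
  have hN0 : (N : ℝ) ≠ 0 := by positivity
  let blk : Fin R → Finset (Label F r R B) := fun ρ => univ.image fun b => Sum.inr (ρ, b)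
  have hblk : ∀ ρ, #(blk ρ) = B := fun ρ => by
    dsimp only [blk]
    rw [card_image_of_injective _ fun b b' h => by simpa using h]
    simp
  have hsub : ({φ : Fin n → Label F r R B | ¬ ∀ ρ, ρ ∈ blocksOf φ S} : Finset _)
      ⊆ univ.biUnion fun ρ => {φ : Fin n → Label F r R B | ∀ x ∈ S, φ x ∈ (blk ρ)ᶜ} := by
    intro φ hφ
    simp only [mem_filter, mem_univ, true_and, not_forall] at hφ
    obtain ⟨ρ, hρ⟩ := hφ
    simp only [mem_biUnion, mem_univ, true_and, mem_filter]
    refine ⟨ρ, fun x hx => ?_⟩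
    simp only [blocksOf, mem_filter, mem_univ, true_and] at hρ
    push Not at hρ
    simpa [blk, eq_comm] using hρ x hx
  have hterm : ∀ ρ, (#{φ : Fin n → Label F r R B | ∀ x ∈ S, φ x ∈ (blk ρ)ᶜ} : ℝ)
      ≤ Real.exp (-(s₀ * B / N)) * (N : ℝ) ^ n := by
    intro ρ
    have hBN : B ≤ N := by
      rw [← hblk ρ]
      exact card_le_univ _
    rw [card_filter_forall_mem_eq, card_compl, hblk, Fintype.card_fin, ← hN]
    gcongr
    rw [Nat.cast_sub hBN, sub_div, div_self hN0]
    calc (1 - (B : ℝ) / N) ^ #S ≤ Real.exp (-(B / N)) ^ #S := by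
          refine pow_le_pow_left₀ (sub_nonneg.2 ?_) (Real.one_sub_le_exp_neg _) _
          rw [div_le_one (by positivity)]
          exact_mod_cast hBN
      _ ≤ Real.exp (-(B / N)) ^ s₀ :=
          pow_le_pow_of_le_one (Real.exp_nonneg _)
            (Real.exp_le_one_iff.2 (neg_nonpos.2 (by positivity))) hS
      _ = _ := by
          rw [← Real.exp_nat_mul]
          congr 1
          ring
  calc (#{φ : Fin n → Label F r R B | ¬ ∀ ρ, ρ ∈ blocksOf φ S} : ℝ)
      ≤ ∑ ρ, (#{φ : Fin n → Label F r R B | ∀ x ∈ S, φ x ∈ (blk ρ)ᶜ} : ℝ) := by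
        exact_mod_cast (card_le_card hsub).trans card_biUnion_le
    _ ≤ ∑ _ρ : Fin R, Real.exp (-(s₀ * B / N)) * (N : ℝ) ^ n := sum_le_sum fun p _ => hterm p
    _ = _ := by
        simp only [sum_const, card_univ, Fintype.card_fin, nsmul_eq_mul, Fintype.card_fun, ← hN]
        push_cast
        ring

open scoped Classical in
/-- Small sets usually meet each part in few elements. -/
lemma card_lt_card_partOf_le (ℓ s₀ : ℕ) (S : Finset (Fin n)) (hS : #S ≤ s₀) :
    (#{φ : Fin n → Label F r R B | ¬ ∀ j, #(partOf φ S j) ≤ ℓ} : ℝ)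
      ≤ r * (s₀ * Fintype.card F / Fintype.card (Label F r R B)) ^ (ℓ + 1)
        * Fintype.card (Fin n → Label F r R B) := by
  set N := Fintype.card (Label F r R B) with hN
  let prt : Fin r → Finset (Label F r R B) := fun j => univ.image fun z => Sum.inl (j, z)
  have hprt : ∀ j, #(prt j) = Fintype.card F := fun j => by
    dsimp only [prt]
    rw [card_image_of_injective _ fun b b' h => by simpa using h, card_univ]
  -- union bound over the part and over the `ℓ + 1` elements of `S` that lie in it
  have hsub : ({φ : Fin n → Label F r R B | ¬ ∀ j, #(partOf φ S j) ≤ ℓ} : Finset _)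
      ⊆ (univ ×ˢ S.powersetCard (ℓ + 1)).biUnion fun p =>
        {φ : Fin n → Label F r R B | ∀ x ∈ p.2, φ x ∈ prt p.1} := by
    intro φ hφ
    simp only [mem_filter, mem_univ, true_and, not_forall, not_le] at hφ
    obtain ⟨j, hj⟩ := hφ
    have hle : #(partOf φ S j) ≤ #(S.filter fun x => φ x ∈ prt j) := by
      have himg : (partOf φ S j).image (fun z => (Sum.inl (j, z) : Label F r R B))
          ⊆ (S.filter fun x => φ x ∈ prt j).image φ := by
        intro y hy
        simp only [mem_image, partOf, mem_filter, mem_univ, true_and] at hy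
        obtain ⟨z, ⟨x, hx, hφx⟩, rfl⟩ := hy
        exact mem_image.2 ⟨x, mem_filter.2 ⟨hx, by simp [prt, hφx]⟩, hφx⟩
      have h1 := card_le_card himg
      rw [card_image_of_injective _ fun b b' h => by simpa using h] at h1
      exact h1.trans card_image_le
    obtain ⟨J, hJ, hJc⟩ := exists_subset_card_eq (Nat.succ_le_of_lt (hj.trans_le hle))
    simp only [mem_biUnion, mem_product, mem_univ, true_and, mem_filter, mem_powersetCard]
    exact ⟨(j, J), ⟨hJ.trans (filter_subset _ _), hJc⟩, fun x hx => (mem_filter.1 (hJ hx)).2⟩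
  have hterm : ∀ p ∈ (univ : Finset (Fin r)) ×ˢ S.powersetCard (ℓ + 1),
      (#{φ : Fin n → Label F r R B | ∀ x ∈ p.2, φ x ∈ prt p.1} : ℝ)
      ≤ (Fintype.card F / N : ℝ) ^ (ℓ + 1) * (N : ℝ) ^ n := by
    rintro ⟨j, J⟩ hp
    simp only [mem_product, mem_univ, true_and, mem_powersetCard] at hp
    rw [card_filter_forall_mem_eq, hprt, hp.2, Fintype.card_fin]
  have hch : ((#S).choose (ℓ + 1) : ℝ) ≤ (s₀ : ℝ) ^ (ℓ + 1) := by
    exact_mod_cast (Nat.choose_le_pow _ _).trans (Nat.pow_le_pow_left hS _)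
  calc (#{φ : Fin n → Label F r R B | ¬ ∀ j, #(partOf φ S j) ≤ ℓ} : ℝ)
      ≤ ∑ p ∈ (univ : Finset (Fin r)) ×ˢ S.powersetCard (ℓ + 1),
        (#{φ : Fin n → Label F r R B | ∀ x ∈ p.2, φ x ∈ prt p.1} : ℝ) := by
        exact_mod_cast (card_le_card hsub).trans card_biUnion_le
    _ ≤ ∑ _p ∈ (univ : Finset (Fin r)) ×ˢ S.powersetCard (ℓ + 1),
        (Fintype.card F / N : ℝ) ^ (ℓ + 1) * (N : ℝ) ^ n := sum_le_sum hterm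
    _ = r * (#S).choose (ℓ + 1) * ((Fintype.card F / N : ℝ) ^ (ℓ + 1) * (N : ℝ) ^ n) := by
        simp only [sum_const, card_product, card_univ, Fintype.card_fin, card_powersetCard,
          nsmul_eq_mul]
        push_cast
        ring
    _ ≤ r * (s₀ : ℝ) ^ (ℓ + 1) * ((Fintype.card F / N : ℝ) ^ (ℓ + 1) * (N : ℝ) ^ n) := by gcongr
    _ = _ := by
        simp only [Fintype.card_fun, Fintype.card_fin, ← hN]
        push_cast
        rw [mul_div_assoc, mul_pow]
        ring

open scoped Classical in
lemma card_revealing_le (ℓ s₀ : ℕ) (S : Finset (Fin n)) :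
    (#{φ : Fin n → Label F r R B | Revealing ℓ φ S} : ℝ)
      ≤ (R * Real.exp (-(s₀ * B / Fintype.card (Label F r R B)))
        + r * (s₀ * Fintype.card F / Fintype.card (Label F r R B)) ^ (ℓ + 1))
        * Fintype.card (Fin n → Label F r R B) := by
  rw [add_mul]
  rcases le_total s₀ #S with hS | hS
  · refine le_trans ?_ (le_add_of_nonneg_right (by positivity))
    refine le_trans ?_ (card_forall_notMem_blocksOf_le s₀ S hS)
    have hsub : ∀ φ : Fin n → Label F r R B, Revealing ℓ φ S → _ := fun φ h => (not_or.1 h).1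
    exact_mod_cast card_le_card fun φ h =>
      mem_filter.2 ⟨mem_univ _, hsub φ (mem_filter.1 h).2⟩
  · refine le_trans ?_ (le_add_of_nonneg_left (by positivity))
    refine le_trans ?_ (card_lt_card_partOf_le ℓ s₀ S hS)
    have hsub : ∀ φ : Fin n → Label F r R B, Revealing ℓ φ S → _ := fun φ h => (not_or.1 h).2
    exact_mod_cast card_le_card fun φ h =>
      mem_filter.2 ⟨mem_univ _, hsub φ (mem_filter.1 h).2⟩

end RandomLabels

/-! ### Hardness with explicit parameters -/

/-- The hardness result with all parameters explicit powers of two: `2 ^ t` parts of `4 ^ t`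
elements, `8 ^ t` masking blocks, and equality of gadgets on sets of at most `2 ^ a` elements.
The margin `2 ^ g` is left between `n` and the number of labels, and between the size at which sets
are masked and the size at which they meet a part in a bounded number of elements. -/
theorem not_optimizable_of_params {n x t a g m : ℕ} {α δ : ℝ} {C : Set (Finset (Fin n) → ℝ)}
    (D : PMF (Finset (Fin n))) (hx : 2 ^ x ≤ n) (hp : 5 * t + 3 * g + 2 ≤ x) (ht : 1 ≤ t)
    (ha : a ≤ 2 * t)
    (hC : ∀ f, IsCoverageOfSize (8 ^ t * (2 ^ t * (4 ^ t + 2 ^ a * (4 ^ t) ^ 2 ^ a) + 1)) f → f ∈ C)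
    (hα : 0 < α) (hδ : 0 ≤ δ)
    (hlt : 8 ^ t * Real.exp (-2 ^ g)
      + m * (8 ^ t * Real.exp (-2 ^ g) + 2 ^ t * (1 / 2 ^ g) ^ (2 ^ a + 1))
      + 4 * (2 ^ a * 2 ^ 2 ^ a) / 2 ^ t / α < 1 - δ) :
    ¬ OptimizableFromSamples C (4 ^ t) D m α δ := by
  classical
  let F := GaloisField 2 (2 * t)
  let _ : Fintype F := Fintype.ofFinite F
  have hF : Fintype.card F = 4 ^ t := by
    rw [← Nat.card_eq_fintype_card, GaloisField.card 2 (2 * t) (by omega), pow_mul]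
    norm_num
  obtain ⟨G, hG⟩ := exists_gadget F (ℓ := 2 ^ a) (by positivity) (by
    rw [hF, show 4 = 2 ^ 2 by norm_num, ← pow_mul]
    exact pow_dvd_pow _ ha)
  obtain ⟨β, hβ⟩ : ∃ β, x = 3 * t + 1 + g + β := ⟨x - (3 * t + 1 + g), by omega⟩
  have hE : (0 : ℝ) ≤ ((2 ^ a : ℕ) : ℝ) * 2 ^ 2 ^ a := by positivity
  have hE1 : (1 : ℝ) ≤ 2 ^ a * 2 ^ 2 ^ a := one_le_mul_of_one_le_of_one_le
    (one_le_pow₀ one_le_two) (one_le_pow₀ one_le_two)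
  have hR : 0 < 8 ^ t := by positivity
  let Λ := Label F (2 ^ t) (8 ^ t) (2 ^ β)
  have : Nonempty Λ := ⟨Sum.inr (⟨0, by positivity⟩, ⟨0, by positivity⟩)⟩
  have : Nonempty (Fin n → Λ) := inferInstance
  have hN : (Fintype.card Λ : ℝ) = 8 ^ t * (1 + 2 ^ β) := by
    simp only [Λ, Label, Fintype.card_sum, Fintype.card_prod, Fintype.card_fin, hF]
    push_cast
    rw [show (8 : ℝ) = 2 * 4 by norm_num, mul_pow]
    ring
  have hβ1 : (1 : ℝ) ≤ 2 ^ β := one_le_pow₀ one_le_two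
  have hpos : (0 : ℝ) < Fintype.card Λ := by rw [hN]; positivity
  have h8 : (8 : ℝ) ^ t = 2 ^ (3 * t) := by rw [pow_mul]; norm_num
  have h4 : (4 : ℝ) ^ t = 2 ^ (2 * t) := by rw [pow_mul]; norm_num
  -- the number of labels leaves a factor `2 ^ g` to `n`; sets of `2 ^ (3 t + 1 + g)` elements hit
  -- a given block `2 ^ g` times and a given part at most `2 ^ (-g)` times on average
  have hmargin1 : (2 : ℝ) ^ g ≤ n / Fintype.card Λ := by
    rw [le_div_iff₀ hpos, hN]
    have : ((2 ^ x : ℕ) : ℝ) ≤ n := by exact_mod_cast hx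
    refine le_trans ?_ this
    push_cast
    rw [hβ, h8, show 3 * t + 1 + g + β = g + 3 * t + (β + 1) by ring, pow_add, pow_add, mul_assoc]
    gcongr
    rw [pow_succ]
    linarith
  have hmargin2 : (2 : ℝ) ^ g
      ≤ (2 ^ (3 * t + 1 + g) : ℕ) * (2 ^ β : ℕ) / Fintype.card Λ := by
    rw [le_div_iff₀ hpos, hN, h8]
    push_cast
    rw [show 3 * t + 1 + g = g + 3 * t + 1 by ring, pow_succ, pow_add, mul_assoc, mul_assoc]
    gcongr
    linarith
  have hmargin3 : ((2 ^ (3 * t + 1 + g) : ℕ) : ℝ) * Fintype.card F / Fintype.card Λ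
      ≤ 1 / 2 ^ g := by
    rw [div_le_div_iff₀ hpos (by positivity), hN, hF, one_mul, h8]
    push_cast
    rw [h4, ← pow_add, ← pow_add]
    calc (2 : ℝ) ^ (3 * t + 1 + g + 2 * t + g) ≤ 2 ^ (3 * t + β) :=
          pow_le_pow_right₀ one_le_two (by omega)
      _ ≤ _ := by
          rw [pow_add]
          gcongr
          linarith
  have hinc : (#{φ : Fin n → Λ | Incomplete φ} : ℝ)
      ≤ (8 ^ t * Real.exp (-2 ^ g)) * Fintype.card (Fin n → Λ) := by
    refine card_incomplete_le.trans ?_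
    rw [hF]
    push_cast
    rw [← mul_pow]
    norm_num only
    gcongr
  have hrev : ∀ S, (#{φ : Fin n → Λ | Revealing (2 ^ a) φ S} : ℝ)
      ≤ (8 ^ t * Real.exp (-2 ^ g) + 2 ^ t * (1 / 2 ^ g) ^ (2 ^ a + 1))
        * Fintype.card (Fin n → Λ) := by
    intro S
    refine (card_revealing_le (2 ^ a) (2 ^ (3 * t + 1 + g)) S).trans ?_
    refine mul_le_mul_of_nonneg_right ?_ (by positivity)
    refine add_le_add ?_ ?_
    · push_cast
      push_cast at hmargin2
      gcongr
    · push_cast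
      push_cast at hmargin3
      gcongr
  have hlast : 0 ≤ 4 * (2 ^ a * 2 ^ 2 ^ a) / 2 ^ t / α := by positivity
  obtain ⟨φ, hφ, hφs⟩ := exists_sampleProb_le D m (Φ := Fin n → Λ)
    (fun φ => Revealing (2 ^ a) φ) Incomplete hrev hinc (by linarith)
  -- such a labelling uses all labels of the parts, so the optimum is at least `4 ^ t`
  simp only [Incomplete, not_exists, not_forall, not_not] at hφ
  have : Nonempty (Fin (2 ^ t)) := ⟨⟨0, by positivity⟩⟩
  refine not_optimizable_of_indistinguishable (ι := Fin (2 ^ t)) (V := 4 ^ t)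
    (β := 4 * (2 ^ a * 2 ^ 2 ^ a) / 2 ^ t) (hidden G φ) (fun i => hC _ ?_)
    (Revealing (2 ^ a) φ) (fun S hS i i' => ?_) hα (by positivity) (fun i => ?_)
    (fun i S => hidden_nonneg G φ i S) (fun S hS => ?_) (by linarith)
  · have := hidden_isCoverageOfSize G φ i
    rwa [hG, hF] at this
  · exact hidden_eq_hidden G hR φ S (not_not.1 hS) i i'
  · choose g hg using fun z => hφ (i, z)
    have h1 : ((4 ^ t : ℕ) : ℝ) ≤ hidden G φ i (univ.image g) := by
      rw [← hF]
      exact card_le_hidden G hR φ i _ fun z => ⟨g z, mem_image_of_mem _ (mem_univ _), hg z⟩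
    push_cast at h1
    refine h1.trans (le_sup' (hidden G φ i) (mem_filter.2 ⟨mem_univ _, ?_⟩))
    rw [← hF]
    exact card_image_le
  · refine (sum_hidden_le G hE hR φ S hS).trans ?_
    rw [hF, Fintype.card_fin]
    push_cast
    set u : ℝ := 2 ^ t with hu
    have hu1 : 1 ≤ u := one_le_pow₀ one_le_two
    have hu2 : (4 : ℝ) ^ t = u ^ 2 := by rw [hu, ← pow_mul, mul_comm, pow_mul]; norm_num
    have hu3 : (8 : ℝ) ^ t = u ^ 3 := by rw [hu, ← pow_mul, mul_comm, pow_mul]; norm_num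
    rw [hu2, hu3]
    generalize (2 : ℝ) ^ a * 2 ^ 2 ^ a = E at hE1 ⊢
    have hu0 : u ≠ 0 := by positivity
    have e1 : u * (u ^ 2 / u ^ 3 * (u ^ 2 + u * E) + u * E) + u ^ 2
        = u ^ 2 + u * E + u ^ 2 * E + u ^ 2 := by field_simp
    have e2 : u * (4 * E / u * u ^ 2) = 4 * (u ^ 2 * E) := by field_simp
    rw [e1, e2]
    have : u * E ≤ u ^ 2 * E := by gcongr; nlinarith
    have : u ^ 2 * 1 ≤ u ^ 2 * E := by gcongr
    linarith

/-! ### Asymptotics -/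

/-- The gadgets for ground sets of about `2 ^ x` elements agree on sets of at most
`2 ^ gadgetLevel x` elements. This bound tends to infinity, but so slowly that a factor exponential
in it is negligible. -/
def gadgetLevel (x : ℕ) : ℕ := Nat.log 2 (Nat.log 2 x)

lemma tendsto_natLog_two : Tendsto (Nat.log 2) atTop atTop :=
  tendsto_atTop.2 fun b => (eventually_ge_atTop (2 ^ b)).mono fun _ hn =>
    Nat.le_log_of_pow_le one_lt_two hn

lemma tendsto_two_pow_gadgetLevel : Tendsto (fun x => (2 : ℝ) ^ gadgetLevel x) atTop atTop :=
  (tendsto_pow_atTop_atTop_of_one_lt one_lt_two).comp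
    (tendsto_natLog_two.comp tendsto_natLog_two)

lemma two_pow_gadgetLevel_le {x : ℕ} (hx : 2 ≤ x) : 2 ^ gadgetLevel x ≤ Nat.log 2 x :=
  Nat.pow_log_le_self 2 (Nat.log_pos one_lt_two hx).ne'

lemma gadget_slack_le {x : ℕ} (hx : 2 ≤ x) :
    (2 : ℝ) ^ gadgetLevel x * 2 ^ 2 ^ gadgetLevel x ≤ (x : ℝ) ^ 2 := by
  have h1 := two_pow_gadgetLevel_le hx
  have h2 : 2 ^ 2 ^ gadgetLevel x ≤ x :=
    (Nat.pow_le_pow_right two_pos h1).trans (Nat.pow_log_le_self 2 (by omega))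
  have h3 : 2 ^ gadgetLevel x ≤ x := h1.trans (Nat.log_le_self 2 x)
  rw [pow_two]
  exact_mod_cast Nat.mul_le_mul h3 h2

lemma sq_le_two_pow {s : ℕ} (hs : 4 ≤ s) : s ^ 2 ≤ 2 ^ s := by
  induction s, hs using Nat.le_induction with
  | base => norm_num
  | succ s hs ih =>
    rw [pow_succ 2 s]
    nlinarith

lemma natLog_two_le_sqrt {x : ℕ} (hx : 9 ≤ x) : Nat.log 2 x ≤ Nat.sqrt x := by
  have hs : 3 ≤ Nat.sqrt x := Nat.le_sqrt'.2 (by omega)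
  have h1 : x < (Nat.sqrt x + 1) ^ 2 := Nat.lt_succ_sqrt' x
  have h2 : x < 2 ^ (Nat.sqrt x + 1) := h1.trans_le (sq_le_two_pow (by omega))
  have := Nat.log_lt_of_lt_pow (by omega) h2
  omega

/-- If the margin exponent `g` is linear in `x`, a polynomial number of samples is harmless, and
hardness holds for every ratio that `x ^ 2 / 2 ^ t` is negligible against. -/
theorem eventually_not_optimizable (t g : ℕ → ℕ) {c : ℝ} (hc : 0 < c) (ρ : ℕ → ℝ) (α : ℕ → ℝ)
    (C : ∀ n, Set (Finset (Fin n) → ℝ))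
    (hp : ∀ᶠ x in atTop, 5 * t x + 3 * g x + 2 ≤ x) (hg : ∀ᶠ x : ℕ in atTop, c * x ≤ g x)
    (ht : ∀ᶠ x in atTop, Nat.log 2 x ≤ t x) (hρ : ∀ x, 0 < ρ x)
    (hlim : Tendsto (fun x : ℕ => (x : ℝ) ^ 2 / 2 ^ t x / ρ x) atTop (nhds 0))
    (hα : ∀ᶠ n in atTop, ρ (Nat.log 2 n) ≤ α n)
    (hC : ∀ᶠ n in atTop, ∀ f : Finset (Fin n) → ℝ,
      IsCoverageOfSize (8 ^ t (Nat.log 2 n) * (2 ^ t (Nat.log 2 n) * (4 ^ t (Nat.log 2 n)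
        + 2 ^ gadgetLevel (Nat.log 2 n)
          * (4 ^ t (Nat.log 2 n)) ^ 2 ^ gadgetLevel (Nat.log 2 n)) + 1)) f → f ∈ C n)
    (d : ℕ) (δ : ℝ) (hδ : 0 ≤ δ) (hδ1 : δ < 1) :
    ∀ᶠ n in atTop, ∀ D : PMF (Finset (Fin n)), ∀ m : ℕ, m ≤ n ^ d →
      ¬ OptimizableFromSamples (C n) (4 ^ t (Nat.log 2 n)) D m (α n) δ := by
  have hlim1 : Tendsto (fun x : ℕ => 3 * (1 / 2 : ℝ) ^ x + 4 * ((x : ℝ) ^ 2 / 2 ^ t x / ρ x))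
      atTop (nhds 0) := by
    have h1 := (tendsto_pow_atTop_nhds_zero_of_lt_one (r := (1 / 2 : ℝ)) (by norm_num)
      (by norm_num)).const_mul 3
    simpa using h1.add (hlim.const_mul 4)
  have hev : ∀ᶠ x : ℕ in atTop, 3 * (1 / 2 : ℝ) ^ x + 4 * ((x : ℝ) ^ 2 / 2 ^ t x / ρ x) < 1 - δ :=
    hlim1.eventually_lt_const (by linarith)
  have hbig : ∀ᶠ x : ℕ in atTop, 2 * (d + 4) / c ≤ 2 ^ gadgetLevel x :=
    tendsto_two_pow_gadgetLevel.eventually_ge_atTop _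
  have hx1 : ∀ᶠ x : ℕ in atTop, 2 * (d + 4) / c ^ 2 ≤ (x : ℝ) :=
    tendsto_natCast_atTop_atTop.eventually_ge_atTop _
  have hx2 : ∀ᶠ x : ℕ in atTop, 4 / c ≤ (x : ℝ) :=
    tendsto_natCast_atTop_atTop.eventually_ge_atTop _
  filter_upwards [hα, hC, eventually_ge_atTop 1, tendsto_natLog_two.eventually hp,
    tendsto_natLog_two.eventually hg, tendsto_natLog_two.eventually ht,
    tendsto_natLog_two.eventually hev, tendsto_natLog_two.eventually hbig,
    tendsto_natLog_two.eventually hx1, tendsto_natLog_two.eventually hx2,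
    tendsto_natLog_two.eventually (eventually_ge_atTop 2)] with n hα hC hn hp hg ht hev hbig hx1 hx2
      hx D m hm
  set x := Nat.log 2 n
  have hxn : 2 ^ x ≤ n := Nat.pow_log_le_self 2 (by omega)
  have hnx : n < 2 ^ (x + 1) := Nat.lt_pow_succ_log_self one_lt_two n
  have hxr : (2 : ℝ) ≤ x := by exact_mod_cast hx
  have hlog : 1 ≤ Nat.log 2 x := Nat.log_pos one_lt_two hx
  have hla : gadgetLevel x ≤ Nat.log 2 x := Nat.log_le_self 2 _
  have hm' : m ≤ 2 ^ ((x + 1) * d) := by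
    rw [pow_mul]
    exact hm.trans (Nat.pow_le_pow_left hnx.le d)
  have hmr : (m : ℝ) ≤ 2 ^ ((x + 1) * d) := by exact_mod_cast hm'
  have hpos : 0 < α n := (hρ x).trans_le hα
  -- sets below the masking threshold meet a part in more than `2 ^ gadgetLevel x` elements with
  -- probability about `2 ^ (-g x * 2 ^ gadgetLevel x)`
  have hA : (x + 1) * (d + 4) ≤ g x * 2 ^ gadgetLevel x := by
    have : ((x : ℝ) + 1) * (d + 4) ≤ g x * 2 ^ gadgetLevel x := by
      calc ((x : ℝ) + 1) * (d + 4) ≤ (2 * x) * (d + 4) := by gcongr; linarith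
        _ = (c * x) * (2 * (d + 4) / c) := by field_simp
        _ ≤ _ := by gcongr
    exact_mod_cast this
  -- blocks or labels are missed with probability about `exp (-2 ^ g x)`
  have hB : (x + 1) * (d + 4) ≤ 2 ^ g x := by
    have hg4 : 4 ≤ g x := by
      have : (4 : ℝ) ≤ g x := by
        rw [div_le_iff₀ hc] at hx2
        linarith
      exact_mod_cast this
    refine le_trans ?_ (sq_le_two_pow hg4)
    have : ((x : ℝ) + 1) * (d + 4) ≤ (g x : ℝ) ^ 2 := by
      calc ((x : ℝ) + 1) * (d + 4) ≤ (2 * x) * (d + 4) := by gcongr; linarith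
        _ = c ^ 2 * x * (2 * (d + 4) / c ^ 2) := by field_simp
        _ ≤ c ^ 2 * x * x := by gcongr
        _ = (c * x) ^ 2 := by ring
        _ ≤ _ := by gcongr
    exact_mod_cast this
  have hexp : Real.exp (-2 ^ g x) ≤ (1 / 2) ^ ((x + 1) * (d + 4)) := by
    have h2 : (((x + 1) * (d + 4) : ℕ) : ℝ) ≤ 2 ^ g x := by exact_mod_cast hB
    calc Real.exp (-2 ^ g x) ≤ Real.exp (((x + 1) * (d + 4) : ℕ) * (-1)) := by
          rw [Real.exp_le_exp]
          linarith
      _ = Real.exp (-1) ^ ((x + 1) * (d + 4)) := Real.exp_nat_mul _ _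
      _ ≤ _ := by
          refine pow_le_pow_left₀ (Real.exp_nonneg _) ?_ _
          rw [Real.exp_neg, ← one_div]
          exact one_div_le_one_div_of_le two_pos (by linarith [Real.add_one_le_exp 1])
  have hpw : ((1 / 2 : ℝ) ^ g x) ^ (2 ^ gadgetLevel x + 1) ≤ (1 / 2) ^ ((x + 1) * (d + 4)) := by
    rw [← pow_mul]
    exact pow_le_pow_of_le_one (by norm_num) (by norm_num) (hA.trans (by gcongr; omega))
  have htx : t x ≤ x := by omega
  have h8 : (8 : ℝ) ^ t x ≤ 2 ^ (3 * (x + 1)) := by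
    rw [show (8 : ℝ) = 2 ^ 3 by norm_num, ← pow_mul]
    exact pow_le_pow_right₀ one_le_two (by omega)
  have h2t : (2 : ℝ) ^ t x ≤ 2 ^ (3 * (x + 1)) := pow_le_pow_right₀ one_le_two (by omega)
  -- `(1 / 2) ^ ((x + 1) (d + 4))` absorbs the number of samples and the number of labels
  have habs : (2 : ℝ) ^ ((x + 1) * d) * (2 ^ (3 * (x + 1)) * (1 / 2) ^ ((x + 1) * (d + 4)))
      = (1 / 2) ^ (x + 1) := by
    rw [show (x + 1) * (d + 4) = (x + 1) * d + 3 * (x + 1) + (x + 1) by ring, pow_add, pow_add,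
      one_div, inv_pow, inv_pow, inv_pow]
    field_simp
  have hsum : 8 ^ t x * Real.exp (-2 ^ g x) + m * (8 ^ t x * Real.exp (-2 ^ g x)
      + 2 ^ t x * (1 / 2 ^ g x) ^ (2 ^ gadgetLevel x + 1)) ≤ 3 * (1 / 2) ^ x := by
    have e1 : 8 ^ t x * Real.exp (-2 ^ g x)
        ≤ 2 ^ (3 * (x + 1)) * (1 / 2) ^ ((x + 1) * (d + 4)) := by gcongr
    have e2 : 2 ^ t x * (1 / 2 ^ g x) ^ (2 ^ gadgetLevel x + 1)
        ≤ (2 : ℝ) ^ (3 * (x + 1)) * (1 / 2) ^ ((x + 1) * (d + 4)) := by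
      rw [← one_div_pow]
      gcongr
    have e3 : (2 : ℝ) ^ (3 * (x + 1)) * (1 / 2) ^ ((x + 1) * (d + 4)) ≤ (1 / 2) ^ (x + 1) := by
      rw [← habs]
      exact le_mul_of_one_le_left (by positivity) (one_le_pow₀ one_le_two)
    have e4 : m * (8 ^ t x * Real.exp (-2 ^ g x)
        + 2 ^ t x * (1 / 2 ^ g x) ^ (2 ^ gadgetLevel x + 1)) ≤ 2 * (1 / 2 : ℝ) ^ (x + 1) := by
      calc m * (8 ^ t x * Real.exp (-2 ^ g x)
            + 2 ^ t x * (1 / 2 ^ g x) ^ (2 ^ gadgetLevel x + 1))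
          ≤ 2 ^ ((x + 1) * d) * (2 ^ (3 * (x + 1)) * (1 / 2) ^ ((x + 1) * (d + 4))
            + 2 ^ (3 * (x + 1)) * (1 / 2) ^ ((x + 1) * (d + 4))) := by gcongr
        _ = _ := by rw [← habs]; ring
    have e5 : (1 / 2 : ℝ) ^ (x + 1) ≤ (1 / 2) ^ x :=
      pow_le_pow_of_le_one (by norm_num) (by norm_num) (by omega)
    linarith
  refine not_optimizable_of_params (g := g x) (a := gadgetLevel x) D hxn hp (by omega) (by omega)
    hC hpos hδ (lt_of_le_of_lt (add_le_add hsum ?_) hev)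
  calc 4 * (2 ^ gadgetLevel x * 2 ^ 2 ^ gadgetLevel x) / 2 ^ t x / α n
      ≤ 4 * (x : ℝ) ^ 2 / 2 ^ t x / ρ x := by
        have := gadget_slack_le hx
        have := hρ x
        gcongr
    _ = _ := by ring

/-! ### The two ratios -/

/-- Polynomial factors are negligible against exponentials of `√x`. -/
lemma tendsto_sq_mul_rpow_neg_sqrt {b : ℝ} (hb : 0 < b) :
    Tendsto (fun x : ℕ => (x : ℝ) ^ 2 * (2 : ℝ) ^ (-(b * √(x : ℝ)))) atTop (nhds 0) := by
  have h1 := tendsto_rpow_mul_exp_neg_mul_atTop_nhds_zero 4 (b * Real.log 2)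
    (mul_pos hb (Real.log_pos one_lt_two))
  have h2 := h1.comp (Real.tendsto_sqrt_atTop.comp
    (tendsto_natCast_atTop_atTop (R := ℝ)))
  refine h2.congr fun x => ?_
  have h4 : √(x : ℝ) ^ (4 : ℝ) = (x : ℝ) ^ 2 := by
    rw [show (4 : ℝ) = ((2 * 2 : ℕ) : ℝ) by norm_num, Real.rpow_natCast, pow_mul,
      Real.sq_sqrt (Nat.cast_nonneg x)]
  simp only [Function.comp]
  rw [h4, Real.rpow_def_of_pos two_pos]
  ring_nf

lemma sqrt_le_natSqrt_add_one (x : ℕ) : √(x : ℝ) ≤ Nat.sqrt x + 1 := by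
  rw [Real.sqrt_le_left (by positivity)]
  exact_mod_cast (Nat.lt_succ_sqrt' x).le

/-- With `4 ^ t` slightly smaller than `n ^ (2 / 5)`, the ratio is slightly larger than
`n ^ (-1 / 5)`. -/
theorem coverage_hardness {ε : ℝ} (hε : 0 < ε) :
    ∃ k : ℕ → ℕ, ∀ (d : ℕ) (δ : ℝ), 0 ≤ δ → δ < 1 →
      ∀ᶠ n : ℕ in atTop, ∀ D : PMF (Finset (Fin n)), ∀ m : ℕ, m ≤ n ^ d →
        ¬ OptimizableFromSamples (coverageFunctions n) (k n) D m
            ((n : ℝ) ^ (-(1 / 5 : ℝ) + ε)) δ := by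
  set e := min ε (1 / 10) with he
  have he0 : 0 < e := lt_min hε (by norm_num)
  have he1 : e ≤ 1 / 10 := min_le_right _ _
  obtain ⟨K, hK⟩ := exists_nat_ge (2 / e)
  have hK20 : 20 ≤ K := by
    have : (20 : ℝ) ≤ K := le_trans (by rw [le_div_iff₀ he0]; linarith) hK
    exact_mod_cast this
  have hK0 : (0 : ℝ) < K := by positivity
  have hdiv : ∀ x : ℕ, x / K ≤ x / 20 := fun x => Nat.div_le_div_left hK20 (by norm_num)
  -- the largest `t` with `5 t + 3 g + 2 ≤ x`; as `K ≥ 2 / e`, the margin costs at most a factor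
  -- `2 ^ (e x / 2)` in the ratio
  let g : ℕ → ℕ := fun x => x / K
  let t : ℕ → ℕ := fun x => (x - 3 * (x / K) - 2) / 5
  let ρ : ℕ → ℝ := fun x => (2 : ℝ) ^ (-((x + 1) * (1 / 5 - e)))
  have hbound : ∀ᶠ x : ℕ in atTop, (x : ℝ) ^ 2 / 2 ^ t x / ρ x
      ≤ 8 * ((x : ℝ) ^ 2 * (2 : ℝ) ^ (-(e / 2 * √(x : ℝ)))) := by
    filter_upwards [eventually_ge_atTop 10] with x hx
    have h20 := hdiv x
    have h1 : x ≤ 5 * t x + 3 * (x / K) + 6 := by dsimp only [t]; omega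
    have h2 : (x : ℝ) ≤ 5 * t x + 3 * ((x / K : ℕ) : ℝ) + 6 := by exact_mod_cast h1
    have h3 : ((x / K : ℕ) : ℝ) ≤ x * (e / 2) := by
      refine Nat.cast_div_le.trans ?_
      rw [div_le_iff₀ hK0]
      rw [div_le_iff₀ he0] at hK
      nlinarith [(Nat.cast_nonneg x : (0 : ℝ) ≤ x)]
    have hx1 : (1 : ℝ) ≤ x := by exact_mod_cast (by omega : 1 ≤ x)
    have h4 : √(x : ℝ) ≤ x := Real.sqrt_le_self_iff.2 (Or.inr hx1)
    have h5 : (2 : ℝ) ^ (-(t x : ℝ)) * (2 : ℝ) ^ ((x + 1) * (1 / 5 - e))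
        ≤ 2 ^ (3 : ℝ) * (2 : ℝ) ^ (-(e / 2 * √(x : ℝ))) := by
      rw [← Real.rpow_add two_pos, ← Real.rpow_add two_pos]
      refine Real.rpow_le_rpow_of_exponent_le one_le_two ?_
      nlinarith
    calc (x : ℝ) ^ 2 / 2 ^ t x / ρ x
        = (x : ℝ) ^ 2 * ((2 : ℝ) ^ (-(t x : ℝ)) * (2 : ℝ) ^ ((x + 1) * (1 / 5 - e))) := by
          dsimp only [ρ]
          rw [Real.rpow_neg two_pos.le, Real.rpow_neg two_pos.le, Real.rpow_natCast, div_inv_eq_mul]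
          ring
      _ ≤ (x : ℝ) ^ 2 * (2 ^ (3 : ℝ) * (2 : ℝ) ^ (-(e / 2 * √(x : ℝ)))) := by gcongr
      _ = _ := by norm_num; ring
  refine ⟨fun n => 4 ^ t (Nat.log 2 n), fun d δ hδ hδ1 => ?_⟩
  refine eventually_not_optimizable t g (c := 1 / (2 * K)) (by positivity) ρ _
    coverageFunctions ?_ ?_ ?_
    (fun x => Real.rpow_pos_of_pos two_pos _) ?_ ?_ (Eventually.of_forall fun n f hf => ⟨_, hf⟩)
    d δ hδ hδ1
  · filter_upwards [eventually_ge_atTop 10] with x hx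
    have := hdiv x
    dsimp only [t, g]
    omega
  · filter_upwards [eventually_ge_atTop (2 * K)] with x hx
    have h1 : x ≤ 2 * K * (x / K) := by
      have h2 := Nat.div_add_mod x K
      have h3 := Nat.mod_lt x (by omega : 0 < K)
      have h4 : K * 1 ≤ K * (x / K) :=
        Nat.mul_le_mul_left K ((Nat.one_le_div_iff (by omega)).2 (by omega))
      linarith
    have h2 : (x : ℝ) ≤ 2 * K * ((x / K : ℕ) : ℝ) := by exact_mod_cast h1
    rw [one_div, inv_mul_le_iff₀ (by positivity)]
    exact h2
  · filter_upwards [eventually_ge_atTop 400] with x hx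
    refine (natLog_two_le_sqrt (by omega)).trans ?_
    have h1 : 20 ≤ Nat.sqrt x := Nat.le_sqrt.2 (by omega)
    have h2 : Nat.sqrt x * Nat.sqrt x ≤ x := Nat.sqrt_le x
    have h3 : 20 * Nat.sqrt x ≤ x := (Nat.mul_le_mul_right _ h1).trans h2
    have := hdiv x
    dsimp only [t]
    omega
  · refine squeeze_zero' (Eventually.of_forall fun x => by positivity) hbound ?_
    simpa using (tendsto_sq_mul_rpow_neg_sqrt (by positivity : 0 < e / 2)).const_mul 8
  · filter_upwards [eventually_ge_atTop 1] with n hn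
    have hn1 : (1 : ℝ) ≤ n := by exact_mod_cast hn
    have hnx : (n : ℝ) ≤ 2 ^ ((Nat.log 2 n : ℝ) + 1) := by
      have : (n : ℝ) ≤ 2 ^ (Nat.log 2 n + 1) := by
        exact_mod_cast (Nat.lt_pow_succ_log_self one_lt_two n).le
      exact_mod_cast this
    calc ρ (Nat.log 2 n) = ((2 : ℝ) ^ ((Nat.log 2 n : ℝ) + 1)) ^ (-(1 / 5 - e)) := by
          dsimp only [ρ]
          rw [← Real.rpow_mul two_pos.le]
          ring_nf
      _ ≤ (n : ℝ) ^ (-(1 / 5 - e)) :=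
          Real.rpow_le_rpow_of_nonpos (by positivity) hnx (by linarith)
      _ ≤ (n : ℝ) ^ (-(1 / 5 : ℝ) + ε) :=
          Real.rpow_le_rpow_of_exponent_le hn1 (by linarith [min_le_left ε (1 / 10)])

/-- With `t` about `√(log₂ n)`, the gadgets have polynomially many items. -/
theorem polySized_coverage_hardness :
    ∃ c : ℝ, 0 < c ∧ ∃ (q : ℕ) (k : ℕ → ℕ), ∀ (d : ℕ) (δ : ℝ), 0 ≤ δ → δ < 1 →
      ∀ᶠ n : ℕ in atTop, ∀ D : PMF (Finset (Fin n)), ∀ m : ℕ, m ≤ n ^ d →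
        ¬ OptimizableFromSamples (polySizedCoverageFunctions q n) (k n) D m
            ((2 : ℝ) ^ (-(c * Real.sqrt (Real.log (n : ℝ))))) δ := by
  let ρ : ℕ → ℝ := fun x => (2 : ℝ) ^ (-(1 / 2 * (√(x : ℝ) + 1)))
  have hbound : ∀ x : ℕ, (x : ℝ) ^ 2 / 2 ^ Nat.sqrt x / ρ x
      ≤ 4 * ((x : ℝ) ^ 2 * (2 : ℝ) ^ (-(1 / 2 * √(x : ℝ)))) := by
    intro x
    have h5 : (2 : ℝ) ^ (-(Nat.sqrt x : ℝ)) * (2 : ℝ) ^ (1 / 2 * (√(x : ℝ) + 1))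
        ≤ 2 ^ (2 : ℝ) * (2 : ℝ) ^ (-(1 / 2 * √(x : ℝ))) := by
      rw [← Real.rpow_add two_pos, ← Real.rpow_add two_pos]
      refine Real.rpow_le_rpow_of_exponent_le one_le_two ?_
      linarith [sqrt_le_natSqrt_add_one x]
    calc (x : ℝ) ^ 2 / 2 ^ Nat.sqrt x / ρ x
        = (x : ℝ) ^ 2 * ((2 : ℝ) ^ (-(Nat.sqrt x : ℝ)) * (2 : ℝ) ^ (1 / 2 * (√(x : ℝ) + 1))) := by
          dsimp only [ρ]
          rw [Real.rpow_neg two_pos.le, Real.rpow_neg two_pos.le, Real.rpow_natCast, div_inv_eq_mul]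
          ring
      _ ≤ (x : ℝ) ^ 2 * (2 ^ (2 : ℝ) * (2 : ℝ) ^ (-(1 / 2 * √(x : ℝ)))) := by gcongr
      _ = _ := by norm_num; ring
  refine ⟨1 / 2, by norm_num, 9, fun n => 4 ^ Nat.sqrt (Nat.log 2 n), fun d δ hδ hδ1 => ?_⟩
  refine eventually_not_optimizable Nat.sqrt (fun x => x / 8) (c := 1 / 16) (by norm_num) ρ _
    (polySizedCoverageFunctions 9) ?_ ?_ ?_ (fun x => Real.rpow_pos_of_pos two_pos _) ?_ ?_ ?_
    d δ hδ hδ1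
  · filter_upwards [eventually_ge_atTop 400] with x hx
    have h1 : 20 ≤ Nat.sqrt x := Nat.le_sqrt.2 (by omega)
    have h2 : Nat.sqrt x * Nat.sqrt x ≤ x := Nat.sqrt_le x
    have h3 : 20 * Nat.sqrt x ≤ x := (Nat.mul_le_mul_right _ h1).trans h2
    omega
  · filter_upwards [eventually_ge_atTop 16] with x hx
    have h1 : (x : ℝ) ≤ 16 * ((x / 8 : ℕ) : ℝ) := by exact_mod_cast (by omega : x ≤ 16 * (x / 8))
    linarith
  · filter_upwards [eventually_ge_atTop 9] with x hx using natLog_two_le_sqrt hx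
  · refine squeeze_zero (fun x => by positivity) hbound ?_
    simpa using (tendsto_sq_mul_rpow_neg_sqrt (by norm_num : (0 : ℝ) < 1 / 2)).const_mul 4
  · filter_upwards [eventually_ge_atTop 1] with n hn
    refine Real.rpow_le_rpow_of_exponent_le one_le_two (neg_le_neg ?_)
    gcongr
    have hn1 : (0 : ℝ) < n := by exact_mod_cast hn
    have hnx : (n : ℝ) ≤ 2 ^ (Nat.log 2 n + 1) := by
      exact_mod_cast (Nat.lt_pow_succ_log_self one_lt_two n).le
    have hlog : Real.log n ≤ Nat.log 2 n + 1 := by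
      calc Real.log n ≤ Real.log (2 ^ (Nat.log 2 n + 1)) := Real.log_le_log hn1 hnx
        _ = ((Nat.log 2 n + 1 : ℕ) : ℝ) * Real.log 2 := Real.log_pow _ _
        _ ≤ ((Nat.log 2 n + 1 : ℕ) : ℝ) * 1 := by
            gcongr
            linarith [Real.log_two_lt_d9]
        _ = _ := by push_cast; ring
    rw [Real.sqrt_le_left (by positivity)]
    nlinarith [Real.sq_sqrt (Nat.cast_nonneg (Nat.log 2 n) : (0 : ℝ) ≤ _),
      Real.sqrt_nonneg (Nat.log 2 n : ℝ)]
  · filter_upwards [eventually_ge_atTop 1,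
      tendsto_natLog_two.eventually (eventually_ge_atTop 9)] with n hn hx f hf
    refine ⟨_, ?_, hf⟩
    set x := Nat.log 2 n
    have hxn : 2 ^ x ≤ n := Nat.pow_log_le_self 2 (by omega)
    have hs : Nat.sqrt x ≤ x := Nat.sqrt_le_self x
    have ha : 2 ^ gadgetLevel x ≤ Nat.sqrt x :=
      (two_pow_gadgetLevel_le (by omega)).trans (natLog_two_le_sqrt hx)
    have h4 : 4 ^ Nat.sqrt x ≤ 2 ^ (2 * x) := by
      rw [show 4 = 2 ^ 2 by norm_num, ← pow_mul]
      exact Nat.pow_le_pow_right two_pos (by omega)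
    have h8 : 8 ^ Nat.sqrt x ≤ 2 ^ (3 * x) := by
      rw [show 8 = 2 ^ 3 by norm_num, ← pow_mul]
      exact Nat.pow_le_pow_right two_pos (by omega)
    have h2 : 2 ^ Nat.sqrt x ≤ 2 ^ x := Nat.pow_le_pow_right two_pos hs
    have hpoly : (4 ^ Nat.sqrt x) ^ 2 ^ gadgetLevel x ≤ 2 ^ (2 * x) := by
      rw [show 4 = 2 ^ 2 by norm_num, ← pow_mul, ← pow_mul]
      refine Nat.pow_le_pow_right two_pos ?_
      calc 2 * (Nat.sqrt x * 2 ^ gadgetLevel x) ≤ 2 * (Nat.sqrt x * Nat.sqrt x) := by gcongr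
        _ ≤ 2 * x := Nat.mul_le_mul_left 2 (Nat.sqrt_le x)
    have ha' : 2 ^ gadgetLevel x ≤ 2 ^ x := (ha.trans hs).trans Nat.lt_two_pow_self.le
    calc 8 ^ Nat.sqrt x * (2 ^ Nat.sqrt x * (4 ^ Nat.sqrt x
          + 2 ^ gadgetLevel x * (4 ^ Nat.sqrt x) ^ 2 ^ gadgetLevel x) + 1)
        ≤ 2 ^ (3 * x) * (2 ^ x * (2 ^ (2 * x) + 2 ^ x * 2 ^ (2 * x)) + 1) := by gcongr
      _ ≤ (2 ^ x) ^ 9 := by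
          have h1 : 4 ≤ 2 ^ x := by
            calc 4 = 2 ^ 2 := by norm_num
              _ ≤ 2 ^ x := Nat.pow_le_pow_right two_pos (by omega)
          rw [mul_comm 3 x, mul_comm 2 x, pow_mul, pow_mul]
          generalize 2 ^ x = y at h1
          have e1 : y ^ 3 * (y * (y ^ 2 + y * y ^ 2) + 1) = y ^ 6 + y ^ 7 + y ^ 3 := by ring
          have e2 : y ^ 6 ≤ y ^ 7 := Nat.pow_le_pow_right (by omega) (by norm_num)
          have e3 : y ^ 3 ≤ y ^ 7 := Nat.pow_le_pow_right (by omega) (by norm_num)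
          have e4 : 4 * 4 * y ^ 7 ≤ y ^ 9 := by
            rw [show y ^ 9 = y * y * y ^ 7 by ring]
            gcongr
          rw [e1]
          omega
      _ ≤ n ^ 9 := Nat.pow_le_pow_left hxn 9

end OPS

theorem mainTheorem1 :
    (∀ ε : ℝ, 0 < ε →
      ∃ k : ℕ → ℕ, ∀ (d : ℕ) (δ : ℝ), 0 ≤ δ → δ < 1 →
        ∀ᶠ n : ℕ in atTop, ∀ D : PMF (Finset (Fin n)), ∀ m : ℕ, m ≤ n ^ d →
          ¬ OPS.OptimizableFromSamples (OPS.coverageFunctions n) (k n) D m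
              ((n : ℝ) ^ (-(1 / 5 : ℝ) + ε)) δ) ∧
    (∃ c : ℝ, 0 < c ∧ ∃ (q : ℕ) (k : ℕ → ℕ), ∀ (d : ℕ) (δ : ℝ), 0 ≤ δ → δ < 1 →
        ∀ᶠ n : ℕ in atTop, ∀ D : PMF (Finset (Fin n)), ∀ m : ℕ, m ≤ n ^ d →
          ¬ OPS.OptimizableFromSamples (OPS.polySizedCoverageFunctions q n) (k n) D m
              ((2 : ℝ) ^ (-(c * Real.sqrt (Real.log (n : ℝ))))) δ) :=
  ⟨fun _ hε => OPS.coverage_hardness hε, OPS.polySized_coverage_hardness⟩
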